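/- Let $M$ be a noncompact smooth Riemannian manifold (finite-dimensional, Hausdorff, without boundary, with smooth metric $g$). A divergent curve in $M$ is a differentiable map $c:[0,T)\to M$, $0<T\le\infty$, such that for every compact set $K\subset M$ there is $t_0\in(0,T)$ with $c(t)\notin K$ for all $t\in(t_0,T)$; its length is $L_g(c)=\lim_{t\to T}\int_0^t|c'(\tau)|_g\,d\tau\in[0,\infty]$. Then $M$ is complete if and only if every divergent curve in $M$ has infinite length. This holds for both usual meanings of "complete" (geodesic and metric) and of "differentiable" (everywhere differentiable and $C^\infty$); that is, the following are equivalent: (1) $M$ is geodesically complete: for every $p\in M$ and $v\in T_pM$ there is a geodesic $\gamma:\mathbb R\to M$, defined for all times, with $\gamma(0)=p$ and $\gamma'(0)=v$; (2) $M$ is complete as a metric space for the Riemannian distance (which is $+\infty$ between points of different connected components, if $M$ is not connected); (3) every divergent curve in $M$ has infinite length; (4) every divergent curve in $M$ that is of class $C^\infty$ has infinite length. -/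

import Mathlib

open Set Manifold Bundle
open scoped Manifold ContDiff ENNReal Topology

noncomputable section

/-! ### Geodesics and geodesic completeness -/

section Geodesic

variable (E : Type*) [NormedAddCommGroup E] [NormedSpace ℝ E]
  {M : Type*} [TopologicalSpace M] [ChartedSpace E M]
  [RiemannianBundle (fun x : M ↦ TangentSpace 𝓘(ℝ, E) x)]

/-- The Riemannian metric read in the preferred chart at `p`: the value at `x` of the pullback of
the metric under the inverse of the chart, evaluated at `v` and `w`
(in coordinates, `∑ gᵢⱼ(x) vⁱ wʲ`). It is meaningful for `x` in the target of the chart. -/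
def chartMetric (p : M) (x v w : E) : ℝ :=
  inner ℝ (mfderiv 𝓘(ℝ, E) 𝓘(ℝ, E) (extChartAt 𝓘(ℝ, E) p).symm x v)
    (mfderiv 𝓘(ℝ, E) 𝓘(ℝ, E) (extChartAt 𝓘(ℝ, E) p).symm x w)

/-- The Christoffel symbols (of the first kind) of the Levi-Civita connection in the preferred
chart at `p`, contracted with `v`, `w`, `z`:
`g (∇_v w, z) = (1 / 2) (∂_v g(w, z) + ∂_w g(v, z) - ∂_z g(v, w))`
for constant vector fields `v`, `w`, `z` in the chart. -/
def christoffelFirst (p : M) (x v w z : E) : ℝ :=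
  (1 / 2 : ℝ) * (fderiv ℝ (fun y ↦ chartMetric E p y w z) x v
    + fderiv ℝ (fun y ↦ chartMetric E p y v z) x w
    - fderiv ℝ (fun y ↦ chartMetric E p y v w) x z)

/-- A smooth curve `γ : ℝ → M`, defined for all times, is a geodesic if its covariant acceleration
vanishes: in each chart, with `u` the curve read in the chart,
`g (u'' + Γ (u', u'), z) = 0` for all vectors `z`. -/
structure IsGeodesic (γ : ℝ → M) : Prop where
  smooth : ContMDiff 𝓘(ℝ, ℝ) 𝓘(ℝ, E) ∞ γ
  equation : ∀ (p : M) (t : ℝ), γ t ∈ (extChartAt 𝓘(ℝ, E) p).source → ∀ z : E,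
    let u : ℝ → E := fun s ↦ extChartAt 𝓘(ℝ, E) p (γ s)
    chartMetric E p (u t) (deriv (deriv u) t) z
      + christoffelFirst E p (u t) (deriv u t) (deriv u t) z = 0

variable (M) in
/-- A Riemannian manifold is (geodesically) complete if, for each point and each tangent vector at
that point, the geodesic with this initial point and this initial velocity is defined on all
of `ℝ`; that is, the exponential map at each point is defined on the whole tangent space. -/
def IsGeodesicallyComplete : Prop :=
  ∀ w : TangentBundle 𝓘(ℝ, E) M, ∃ γ : ℝ → M, IsGeodesic E γ ∧
    (⟨γ 0, mfderiv 𝓘(ℝ, ℝ) 𝓘(ℝ, E) γ 0 (1 : ℝ)⟩ : TangentBundle 𝓘(ℝ, E) M) = w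

end Geodesic

/-! ### Divergent curves -/

section Divergent

/-- The half-open interval `[0, T)` of real numbers, where `T` may be `+∞`. -/
def zeroIco (T : EReal) : Set ℝ := {t : ℝ | 0 ≤ t ∧ (t : EReal) < T}

variable (E : Type*) [NormedAddCommGroup E] [NormedSpace ℝ E]
  {M : Type*} [TopologicalSpace M] [ChartedSpace E M]

/-- A divergent curve: a differentiable map `c : [0, T) → M`, where `0 < T ≤ +∞`, that eventually
leaves each compact set for good. The values of `c` outside `[0, T)` play no role. -/
structure IsDivergentCurve (T : EReal) (c : ℝ → M) : Prop where
  pos : 0 < T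
  differentiable : MDifferentiableOn 𝓘(ℝ, ℝ) 𝓘(ℝ, E) c (zeroIco T)
  escapes : ∀ K : Set M, IsCompact K →
    ∃ t₀ : ℝ, 0 < t₀ ∧ (t₀ : EReal) < T ∧ ∀ t : ℝ, t₀ < t → (t : EReal) < T → c t ∉ K

/-- The length of a curve `c : [0, T) → M`: the limit as `t → T` of the nondecreasing function
`t ↦ ∫₀ᵗ |c'(τ)| dτ`, that is, its supremum. -/
def curveLength [RiemannianBundle (fun x : M ↦ TangentSpace 𝓘(ℝ, E) x)]
    (T : EReal) (c : ℝ → M) : ℝ≥0∞ :=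
  ⨆ t ∈ zeroIco T, pathELength 𝓘(ℝ, E) c 0 t

end Divergent

end

/-!
The four conditions are proved equivalent in a cycle.

*Geodesic completeness implies metric completeness* by the argument of Hopf and Rinow, applied to
an ideal point of `M`: the limit of a Cauchy ultrafilter, whose distance `f x` to a point `x` of `M`
is defined although the ideal point is not yet known to belong to `M`. A path from `x` toward the
ideal point crosses every small sphere around `x`, which is compact, so a point of the sphere is
closer to the ideal point by exactly its radius (`eventually_exists_edist_eq`). Hence some unit
speed geodesic from `x` moves toward the ideal point at unit rate for a short time. By completeness
this geodesic is defined for all times, and the set of times up to which it moves at unit rate is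
closed; it is open because a minimizing concatenation of two unit speed geodesics has no corner
(`deriv_chartCurve_eq_of_minimizing`), so that by uniqueness the second one continues the first.
At time `f x` the geodesic has reached the ideal point. This needs that points close to `x` are
joined to `x` by minimizing geodesics
(`IsGeodesicallyComplete.eventually_exists_minimizing`). Existence holds because, in a chart, the
endpoint of a geodesic with small initial velocity is almost a translation of this velocity
(`norm_endpoint_sub_le`). Minimality avoids the Gauss lemma: in a small chart ball, the energy of a
competing curve is at least that of the geodesic, by the Taylor formula and an integration by parts
(`IsMetricOn.exists_energy_le`), and the competing curve can be parametrized so that its energy is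
almost its squared length (`exists_reparametrization`).

*Metric completeness implies that divergent curves have infinite length*: the distance between two
points of a curve that is merely differentiable is at most twice the length between them, so a
divergent curve of finite length would converge, and stay in a compact neighbourhood of its limit.

*If smooth divergent curves have infinite length, geodesics exist for all times*: a geodesic on
a bounded interval has constant speed, hence finite length, so it is not divergent and returns to
a compact set arbitrarily close to the end of the interval. It accumulates at some point `q`,
around which geodesics of bounded speed exist for a uniform time (`exists_isGeodesicAt`); restarting
from a point close to `q` extends the geodesic (`exists_isGeodesicAt_extension`).

Geodesics are handled in charts, where the metric is a smooth family `G` of bilinear forms on an open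
subset of `E` (`IsMetricOn`). The geodesic equation can be checked in a single chart
(`IsGeodesicAt.of_chart`).
-/

set_option linter.unusedSectionVars false
set_option maxSynthPendingDepth 3

noncomputable section


/-! ### The metric in a chart -/

section ChartMetric

variable {E : Type*} [NormedAddCommGroup E] [NormedSpace ℝ E] [FiniteDimensional ℝ E]
  {M : Type*} [TopologicalSpace M] [ChartedSpace E M] [IsManifold 𝓘(ℝ, E) ∞ M]

lemma mdifferentiableAt_extChartAt_symm {p : M} {x : E}
    (hx : x ∈ (extChartAt 𝓘(ℝ, E) p).target) :
    MDifferentiableAt 𝓘(ℝ, E) 𝓘(ℝ, E) (extChartAt 𝓘(ℝ, E) p).symm x :=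
  (mdifferentiableOn_extChartAt_symm x hx).mdifferentiableAt
    ((isOpen_extChartAt_target p).mem_nhds hx)

lemma contMDiffAt_extChartAt_symm {p : M} {x : E}
    (hx : x ∈ (extChartAt 𝓘(ℝ, E) p).target) :
    ContMDiffAt 𝓘(ℝ, E) 𝓘(ℝ, E) ∞ (extChartAt 𝓘(ℝ, E) p).symm x :=
  (contMDiffOn_extChartAt_symm p x hx).contMDiffAt ((isOpen_extChartAt_target p).mem_nhds hx)

/-- The derivative of the inverse of the preferred chart at `p`, at a point `x` of the chart,
as a map from the model space `E`. -/
def chartSymmDeriv (p : M) (x : E) :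
    E →L[ℝ] TangentSpace 𝓘(ℝ, E) ((extChartAt 𝓘(ℝ, E) p).symm x) :=
  mfderiv 𝓘(ℝ, E) 𝓘(ℝ, E) (extChartAt 𝓘(ℝ, E) p).symm x

/-- The derivative of the preferred chart at `p`, at a point `y` of the manifold, as a map to the
model space `E`. -/
def chartDeriv (p : M) (y : M) : TangentSpace 𝓘(ℝ, E) y →L[ℝ] E :=
  mfderiv 𝓘(ℝ, E) 𝓘(ℝ, E) (extChartAt 𝓘(ℝ, E) p) y

lemma chartDeriv_chartSymmDeriv {p : M} {x : E} (hx : x ∈ (extChartAt 𝓘(ℝ, E) p).target)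
    (v : E) : chartDeriv p ((extChartAt 𝓘(ℝ, E) p).symm x) (chartSymmDeriv p x v) = v := by
  have h := mfderiv_extChartAt_comp_mfderivWithin_extChartAt_symm (I := 𝓘(ℝ, E)) hx
  rw [modelWithCornersSelf_coe, range_id, mfderivWithin_univ] at h
  exact congr($h v)

lemma chartSymmDeriv_chartDeriv {p : M} {x : E} (hx : x ∈ (extChartAt 𝓘(ℝ, E) p).target)
    (w : TangentSpace 𝓘(ℝ, E) ((extChartAt 𝓘(ℝ, E) p).symm x)) :
    chartSymmDeriv p x (chartDeriv p ((extChartAt 𝓘(ℝ, E) p).symm x) w) = w := by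
  have h := mfderivWithin_extChartAt_symm_comp_mfderiv_extChartAt (I := 𝓘(ℝ, E)) hx
  rw [modelWithCornersSelf_coe, range_id, mfderivWithin_univ] at h
  exact congr($h w)

lemma chartDeriv_injective {p y : M} (hy : y ∈ (extChartAt 𝓘(ℝ, E) p).source) :
    Function.Injective (chartDeriv (E := E) p y) := by
  obtain ⟨x, hx, rfl⟩ : ∃ x ∈ (extChartAt 𝓘(ℝ, E) p).target, (extChartAt 𝓘(ℝ, E) p).symm x = y :=
    ⟨_, (extChartAt 𝓘(ℝ, E) p).map_source hy, (extChartAt 𝓘(ℝ, E) p).left_inv hy⟩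
  exact Function.LeftInverse.injective (chartSymmDeriv_chartDeriv hx)

lemma chartDeriv_surjective {p y : M} (hy : y ∈ (extChartAt 𝓘(ℝ, E) p).source) :
    Function.Surjective (chartDeriv (E := E) p y) := by
  obtain ⟨x, hx, rfl⟩ : ∃ x ∈ (extChartAt 𝓘(ℝ, E) p).target, (extChartAt 𝓘(ℝ, E) p).symm x = y :=
    ⟨_, (extChartAt 𝓘(ℝ, E) p).map_source hy, (extChartAt 𝓘(ℝ, E) p).left_inv hy⟩
  exact Function.RightInverse.surjective (chartDeriv_chartSymmDeriv hx)

lemma chartSymmDeriv_surjective {p : M} {x : E} (hx : x ∈ (extChartAt 𝓘(ℝ, E) p).target) :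
    Function.Surjective (chartSymmDeriv (E := E) p x) :=
  Function.RightInverse.surjective (chartSymmDeriv_chartDeriv hx)

/-- The velocity of a curve in a manifold. -/
def velocity (c : ℝ → M) (t : ℝ) : TangentSpace 𝓘(ℝ, E) (c t) :=
  mfderiv 𝓘(ℝ, ℝ) 𝓘(ℝ, E) c t (1 : ℝ)

variable (E) in
/-- A curve read in the preferred chart at `p`. -/
def chartCurve (p : M) (c : ℝ → M) (t : ℝ) : E := extChartAt 𝓘(ℝ, E) p (c t)

lemma hasDerivAt_chartCurve {p : M} {c : ℝ → M} {t : ℝ}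
    (hc : MDifferentiableAt 𝓘(ℝ, ℝ) 𝓘(ℝ, E) c t) (ht : c t ∈ (extChartAt 𝓘(ℝ, E) p).source) :
    HasDerivAt (chartCurve E p c) (chartDeriv p (c t) (velocity c t)) t := by
  have h1 := mdifferentiableAt_extChartAt (I := 𝓘(ℝ, E)) (by simpa using ht)
  have h : HasFDerivAt (chartCurve E p c) ((chartDeriv p (c t)).comp
      (mfderiv 𝓘(ℝ, ℝ) 𝓘(ℝ, E) c t : ℝ →L[ℝ] TangentSpace 𝓘(ℝ, E) (c t))) t :=
    (h1.hasMFDerivAt.comp t hc.hasMFDerivAt).hasFDerivAt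
  exact h.hasDerivAt

lemma chartDeriv_velocity {p : M} {c : ℝ → M} {t : ℝ}
    (hc : MDifferentiableAt 𝓘(ℝ, ℝ) 𝓘(ℝ, E) c t) (ht : c t ∈ (extChartAt 𝓘(ℝ, E) p).source) :
    chartDeriv p (c t) (velocity c t) = deriv (chartCurve E p c) t :=
  (hasDerivAt_chartCurve hc ht).deriv.symm

variable [RiemannianBundle (fun x : M ↦ TangentSpace 𝓘(ℝ, E) x)]

lemma chartMetric_eq (p : M) (x v w : E) :
    chartMetric E p x v w = inner ℝ (chartSymmDeriv p x v) (chartSymmDeriv p x w) := rfl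

/-- The metric in the preferred chart at `p`, bundled as a continuous bilinear form depending on
the point of the chart. -/
def chartForm (p : M) (x : E) : E →L[ℝ] E →L[ℝ] ℝ :=
  LinearMap.toContinuousBilinearMap (LinearMap.mk₂ ℝ (chartMetric E p x)
    (fun v v' w ↦ by simp only [chartMetric_eq, map_add, inner_add_left])
    (fun c v w ↦ by simp only [chartMetric_eq, map_smul, real_inner_smul_left, smul_eq_mul])
    (fun v w w' ↦ by simp only [chartMetric_eq, map_add, inner_add_right])
    (fun c v w ↦ by simp only [chartMetric_eq, map_smul, real_inner_smul_right, smul_eq_mul]))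

lemma chartForm_apply (p : M) (x v w : E) : chartForm p x v w = chartMetric E p x v w := rfl

lemma chartForm_apply_eq_inner (p : M) (x v w : E) :
    chartForm p x v w = inner ℝ (chartSymmDeriv p x v) (chartSymmDeriv p x w) := rfl

lemma chartForm_symm (p : M) (x v w : E) : chartForm p x v w = chartForm p x w v := by
  simp only [chartForm_apply_eq_inner]
  exact real_inner_comm _ _

lemma chartForm_pos {p : M} {x : E} (hx : x ∈ (extChartAt 𝓘(ℝ, E) p).target) {v : E}
    (hv : v ≠ 0) : 0 < chartForm p x v v := by
  rw [chartForm_apply_eq_inner]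
  refine real_inner_self_pos.2 fun h ↦ hv ?_
  rw [← chartDeriv_chartSymmDeriv hx v, h, map_zero]

lemma contMDiffOn_chartSymmDeriv (p : M) (v : E) :
    ContMDiffOn 𝓘(ℝ, E) (𝓘(ℝ, E).prod 𝓘(ℝ, E)) ∞
      (fun x ↦ (⟨(extChartAt 𝓘(ℝ, E) p).symm x, chartSymmDeriv p x v⟩ : TangentBundle 𝓘(ℝ, E) M))
      (extChartAt 𝓘(ℝ, E) p).target := by
  have h := (contMDiffOn_extChartAt_symm (I := 𝓘(ℝ, E)) (n := ∞) p).contMDiffOn_tangentMapWithin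
    (m := ∞) (by simp) (isOpen_extChartAt_target p).uniqueMDiffOn
  have h2 : ContMDiff 𝓘(ℝ, E) (𝓘(ℝ, E).prod 𝓘(ℝ, E)) ∞
      (fun x : E ↦ (⟨x, v⟩ : TangentBundle 𝓘(ℝ, E) E)) :=
    contMDiff_vectorSpace_iff_contDiff.2 contDiff_const
  refine (h.comp h2.contMDiffOn (fun x hx ↦ hx)).congr fun x hx ↦ ?_
  simp only [Function.comp_apply, tangentMapWithin]
  rw [mfderivWithin_of_isOpen (isOpen_extChartAt_target p) hx]
  rfl

variable [IsContMDiffRiemannianBundle 𝓘(ℝ, E) ∞ E (fun x : M ↦ TangentSpace 𝓘(ℝ, E) x)]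

lemma contDiffOn_chartForm (p : M) :
    ContDiffOn ℝ ∞ (chartForm p : E → E →L[ℝ] E →L[ℝ] ℝ) (extChartAt 𝓘(ℝ, E) p).target := by
  simp_rw [contDiffOn_clm_apply, ← contMDiffOn_iff_contDiffOn]
  intro v w
  exact ContMDiffOn.inner_bundle (E := fun x : M ↦ TangentSpace 𝓘(ℝ, E) x)
    (contMDiffOn_chartSymmDeriv p v) (contMDiffOn_chartSymmDeriv p w)

lemma christoffelFirst_eq {p : M} {x : E} (hx : x ∈ (extChartAt 𝓘(ℝ, E) p).target) (v w z : E) :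
    christoffelFirst E p x v w z = (1 / 2 : ℝ) * (fderiv ℝ (chartForm p) x v w z
      + fderiv ℝ (chartForm p) x w v z - fderiv ℝ (chartForm p) x z v w) := by
  have hd : DifferentiableAt ℝ (chartForm p : E → E →L[ℝ] E →L[ℝ] ℝ) x :=
    ((contDiffOn_chartForm p).contDiffAt ((isOpen_extChartAt_target p).mem_nhds hx)).differentiableAt
      (by simp)
  have key (a b c : E) : fderiv ℝ (fun y ↦ chartMetric E p y a b) x c
      = fderiv ℝ (chartForm p) x c a b := by
    simp_rw [← chartForm_apply]
    exact ((hd.hasFDerivAt.clm_apply (hasFDerivAt_const a x)).clm_apply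
      (hasFDerivAt_const b x)).fderiv ▸ by simp
  simp only [christoffelFirst, key]

lemma chartForm_chartDeriv {p y : M} (hy : y ∈ (extChartAt 𝓘(ℝ, E) p).source)
    (v w : TangentSpace 𝓘(ℝ, E) y) :
    chartForm p (extChartAt 𝓘(ℝ, E) p y) (chartDeriv p y v) (chartDeriv p y w) = inner ℝ v w := by
  obtain ⟨x, hx, rfl⟩ : ∃ x ∈ (extChartAt 𝓘(ℝ, E) p).target, (extChartAt 𝓘(ℝ, E) p).symm x = y :=
    ⟨_, (extChartAt 𝓘(ℝ, E) p).map_source hy, (extChartAt 𝓘(ℝ, E) p).left_inv hy⟩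
  rw [(extChartAt 𝓘(ℝ, E) p).right_inv hx, chartForm_apply_eq_inner, chartSymmDeriv_chartDeriv hx,
    chartSymmDeriv_chartDeriv hx]

/-- The squared speed of a curve, computed in the preferred chart at `p`. -/
lemma norm_velocity_sq {p : M} {c : ℝ → M} {t : ℝ}
    (hc : MDifferentiableAt 𝓘(ℝ, ℝ) 𝓘(ℝ, E) c t) (ht : c t ∈ (extChartAt 𝓘(ℝ, E) p).source) :
    ‖velocity (E := E) c t‖ ^ 2 = chartForm p (chartCurve E p c t)
      (deriv (chartCurve E p c) t) (deriv (chartCurve E p c) t) := by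
  rw [← chartDeriv_velocity hc ht]
  exact (real_inner_self_eq_norm_sq _).symm.trans (chartForm_chartDeriv ht _ _).symm

lemma enorm_velocity {p : M} {c : ℝ → M} {t : ℝ}
    (hc : MDifferentiableAt 𝓘(ℝ, ℝ) 𝓘(ℝ, E) c t) (ht : c t ∈ (extChartAt 𝓘(ℝ, E) p).source) :
    ‖velocity (E := E) c t‖ₑ = ENNReal.ofReal (√ (chartForm p (chartCurve E p c t)
      (deriv (chartCurve E p c) t) (deriv (chartCurve E p c) t))) := by
  rw [← norm_velocity_sq hc ht, Real.sqrt_sq (norm_nonneg _), ofReal_norm]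

lemma pathELength_eq_lintegral_velocity (c : ℝ → M) (a b : ℝ) :
    pathELength 𝓘(ℝ, E) c a b = ∫⁻ t in Icc a b, ‖velocity (E := E) c t‖ₑ :=
  pathELength_eq_lintegral_mfderiv_Icc

end ChartMetric

/-! ### Metrics on open subsets of a vector space and the geodesic equation -/

section LocalMetric

variable {E : Type*} [NormedAddCommGroup E] [NormedSpace ℝ E] [FiniteDimensional ℝ E]

/-- A smooth Riemannian metric on an open subset `U` of a vector space. -/
structure IsMetricOn (G : E → E →L[ℝ] E →L[ℝ] ℝ) (U : Set E) : Prop where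
  isOpen : IsOpen U
  contDiffOn : ContDiffOn ℝ ∞ G U
  symm : ∀ x v w, G x v w = G x w v
  pos : ∀ x ∈ U, ∀ v, v ≠ 0 → 0 < G x v v

lemma exists_pos_mul_sq_norm_le (B : E →L[ℝ] E →L[ℝ] ℝ) (hB : ∀ v, v ≠ 0 → 0 < B v v) :
    ∃ c > 0, ∀ v, c * ‖v‖ ^ 2 ≤ B v v := by
  rcases (Metric.sphere (0 : E) 1).eq_empty_or_nonempty with h | h
  · refine ⟨1, one_pos, fun v ↦ ?_⟩
    by_cases hv : v = 0
    · simp [hv]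
    · exfalso
      have : (‖v‖⁻¹ • v) ∈ Metric.sphere (0 : E) 1 := by
        simp [norm_smul, hv]
      rw [h] at this
      exact this
  · obtain ⟨v₀, hv₀, hmin⟩ := (isCompact_sphere (0 : E) 1).exists_isMinOn h
      (f := fun v ↦ B v v) (by fun_prop)
    have hv₀' : v₀ ≠ 0 := by
      rintro rfl
      simp at hv₀
    refine ⟨B v₀ v₀, hB v₀ hv₀', fun v ↦ ?_⟩
    by_cases hv : v = 0
    · simp [hv]
    · have h1 : B v₀ v₀ ≤ B (‖v‖⁻¹ • v) (‖v‖⁻¹ • v) := hmin (by simp [norm_smul, hv])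
      simp only [map_smul, smul_apply, smul_eq_mul] at h1
      have h2 : 0 < ‖v‖ := norm_pos_iff.2 hv
      calc B v₀ v₀ * ‖v‖ ^ 2 ≤ (‖v‖⁻¹ * (‖v‖⁻¹ * B v v)) * ‖v‖ ^ 2 := by gcongr
        _ = B v v := by field_simp

variable (E) in
/-- The linear map sending a trilinear form `D` to
`(v, w, z) ↦ D (v, w, z) - (1 / 2) D (z, v, w)`. -/
def christoffelMap : (E →L[ℝ] E →L[ℝ] E →L[ℝ] ℝ) →L[ℝ] (E →L[ℝ] E →L[ℝ] E →L[ℝ] ℝ) :=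
  .id ℝ _ - (1 / 2 : ℝ) •
    (ContinuousLinearMap.compL ℝ E (E →L[ℝ] E →L[ℝ] ℝ) (E →L[ℝ] E →L[ℝ] ℝ)
      (ContinuousLinearMap.flipₗᵢ ℝ E E ℝ : (E →L[ℝ] E →L[ℝ] ℝ) →L[ℝ] (E →L[ℝ] E →L[ℝ] ℝ))).comp
      (ContinuousLinearMap.flipₗᵢ ℝ E E (E →L[ℝ] ℝ) :
        (E →L[ℝ] E →L[ℝ] E →L[ℝ] ℝ) →L[ℝ] (E →L[ℝ] E →L[ℝ] E →L[ℝ] ℝ))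

/-- The trilinear form `(v, w, z) ↦ ∂_v g (w, z) - (1 / 2) ∂_z g (v, w)`. It agrees with the
Christoffel symbols of the first kind on the diagonal `v = w`, which is all that enters the
geodesic equation. -/
def christoffelForm (G : E → E →L[ℝ] E →L[ℝ] ℝ) (x : E) : E →L[ℝ] E →L[ℝ] E →L[ℝ] ℝ :=
  christoffelMap E (fderiv ℝ G x)

lemma christoffelForm_apply (G : E → E →L[ℝ] E →L[ℝ] ℝ) (x v w z : E) :
    christoffelForm G x v w z = fderiv ℝ G x v w z - (1 / 2 : ℝ) * fderiv ℝ G x z v w := by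
  simp [christoffelForm, christoffelMap]

/-- The form `christoffelForm` with its last index raised by the metric. With this form `B`, the
geodesic equation reads `u'' = - B u (u', u')`. -/
def connectionForm (G : E → E →L[ℝ] E →L[ℝ] ℝ) (x : E) : E →L[ℝ] E →L[ℝ] E :=
  (ContinuousLinearMap.compL ℝ E (E →L[ℝ] ℝ) E (G x).inverse).comp (christoffelForm G x)

lemma connectionForm_apply (G : E → E →L[ℝ] E →L[ℝ] ℝ) (x v w : E) :
    connectionForm G x v w = (G x).inverse (christoffelForm G x v w) := by
  simp [connectionForm]

/-- The geodesic equation in a vector space with the metric `G`, for a curve `u` at time `t`. -/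
def GeodesicEq (G : E → E →L[ℝ] E →L[ℝ] ℝ) (u : ℝ → E) (t : ℝ) : Prop :=
  ∀ z, G (u t) (deriv (deriv u) t) z + christoffelForm G (u t) (deriv u t) (deriv u t) z = 0

variable {G : E → E →L[ℝ] E →L[ℝ] ℝ} {U : Set E}

namespace IsMetricOn

lemma contDiffAt (hG : IsMetricOn G U) {x : E} (hx : x ∈ U) : ContDiffAt ℝ ∞ G x :=
  hG.contDiffOn.contDiffAt (hG.isOpen.mem_nhds hx)

lemma contDiffAt_fderiv (hG : IsMetricOn G U) {x : E} (hx : x ∈ U) :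
    ContDiffAt ℝ ∞ (fderiv ℝ G) x :=
  (hG.contDiffAt hx).fderiv_right (by simp)

lemma hasFDerivAt (hG : IsMetricOn G U) {x : E} (hx : x ∈ U) :
    HasFDerivAt G (fderiv ℝ G x) x :=
  ((hG.contDiffAt hx).differentiableAt (by simp)).hasFDerivAt

lemma nonneg (hG : IsMetricOn G U) {x : E} (hx : x ∈ U) (v : E) : 0 ≤ G x v v := by
  by_cases hv : v = 0
  · simp [hv]
  · exact (hG.pos x hx v hv).le

lemma isInvertible (hG : IsMetricOn G U) {x : E} (hx : x ∈ U) : (G x).IsInvertible := by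
  have hinj : Function.Injective (G x) := by
    rw [injective_iff_map_eq_zero]
    intro v hv
    by_contra h
    have := hG.pos x hx v h
    simp [hv] at this
  have hrank : Module.finrank ℝ E = Module.finrank ℝ (E →L[ℝ] ℝ) := by
    rw [← (LinearMap.toContinuousLinearMap : (E →ₗ[ℝ] ℝ) ≃ₗ[ℝ] (E →L[ℝ] ℝ)).finrank_eq]
    exact Subspace.dual_finrank_eq.symm
  exact ⟨(LinearEquiv.ofInjectiveOfFinrankEq (G x : E →ₗ[ℝ] (E →L[ℝ] ℝ)) hinj
    hrank).toContinuousLinearEquiv, by ext; rfl⟩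

lemma contDiffAt_christoffelForm (hG : IsMetricOn G U) {x : E} (hx : x ∈ U) :
    ContDiffAt ℝ ∞ (christoffelForm G) x := by
  have h := hG.contDiffAt_fderiv hx
  exact (christoffelMap E).contDiff.contDiffAt.comp x h

lemma contDiffAt_connectionForm (hG : IsMetricOn G U) {x : E} (hx : x ∈ U) :
    ContDiffAt ℝ ∞ (connectionForm G) x := by
  have h1 : ContDiffAt ℝ ∞ (fun y ↦ (G y).inverse) x :=
    ((hG.isInvertible hx).contDiffAt_map_inverse).comp x (hG.contDiffAt hx)
  unfold connectionForm
  exact ((ContinuousLinearMap.contDiff _).contDiffAt.comp x h1).clm_comp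
    (hG.contDiffAt_christoffelForm hx)

lemma geodesicEq_iff (hG : IsMetricOn G U) {u : ℝ → E} {t : ℝ} (hu : u t ∈ U) :
    GeodesicEq G u t ↔ deriv (deriv u) t = - connectionForm G (u t) (deriv u t) (deriv u t) := by
  obtain ⟨e, he⟩ := hG.isInvertible hu
  rw [connectionForm_apply, GeodesicEq, ← he, ContinuousLinearMap.inverse_equiv]
  constructor
  · intro h
    have h' : e (deriv (deriv u) t) = - christoffelForm G (u t) (deriv u t) (deriv u t) := by
      ext z
      exact eq_neg_of_add_eq_zero_left (h z)
    rw [← e.symm_apply_apply (deriv (deriv u) t), h', map_neg]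
    rfl
  · intro h z
    rw [h]
    simp

/-- Near a point the metric is comparable to the norm, and is Lipschitz with Lipschitz
derivative. -/
lemma exists_bounds (hG : IsMetricOn G U) {x₀ : E} (hx₀ : x₀ ∈ U) :
    ∃ ρ > 0, ∃ c > 0, ∃ C > 0, Metric.closedBall x₀ ρ ⊆ U ∧
      (∀ x ∈ Metric.closedBall x₀ ρ, ∀ v, c * ‖v‖ ^ 2 ≤ G x v v) ∧
      (∀ x ∈ Metric.closedBall x₀ ρ, ∀ y ∈ Metric.closedBall x₀ ρ, ‖G x - G y‖ ≤ C * ‖x - y‖) ∧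
      (∀ x ∈ Metric.closedBall x₀ ρ, ∀ y ∈ Metric.closedBall x₀ ρ,
        ‖fderiv ℝ G x - fderiv ℝ G y‖ ≤ C * ‖x - y‖) := by
  obtain ⟨c, hc, hcG⟩ := exists_pos_mul_sq_norm_le (G x₀) (hG.pos x₀ hx₀)
  obtain ⟨K₁, s₁, hs₁, hK₁⟩ := ((hG.contDiffAt hx₀).of_le (by simp)).exists_lipschitzOnWith
  obtain ⟨K₂, s₂, hs₂, hK₂⟩ := ((hG.contDiffAt_fderiv hx₀).of_le (by simp)).exists_lipschitzOnWith
  have h3 : ∀ᶠ x in 𝓝 x₀, ‖G x - G x₀‖ < c / 2 := by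
    have := (hG.contDiffAt hx₀).continuousAt
    have := Metric.continuousAt_iff'.1 this (c / 2) (by positivity)
    simpa only [dist_eq_norm] using this
  obtain ⟨ρ, hρ, hsub⟩ := Metric.nhds_basis_closedBall.mem_iff.1
    (Filter.inter_mem (Filter.inter_mem hs₁ hs₂) (Filter.inter_mem h3 (hG.isOpen.mem_nhds hx₀)))
  refine ⟨ρ, hρ, c / 2, by positivity, K₁ + K₂ + 1, by positivity,
    fun x hx ↦ (hsub hx).2.2, fun x hx v ↦ ?_, fun x hx y hy ↦ ?_, fun x hx y hy ↦ ?_⟩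
  · have h1 : ‖(G x - G x₀) v v‖ ≤ c / 2 * ‖v‖ * ‖v‖ :=
      ((G x - G x₀).le_opNorm₂ v v).trans (by gcongr; exact (hsub hx).2.1.le)
    have h2 := hcG v
    simp only [sub_apply, Real.norm_eq_abs] at h1
    nlinarith [abs_le.1 h1]
  · have := hK₁.dist_le_mul x (hsub hx).1.1 y (hsub hy).1.1
    rw [dist_eq_norm, dist_eq_norm] at this
    refine this.trans ?_
    gcongr
    have := K₂.coe_nonneg
    linarith
  · have := hK₂.dist_le_mul x (hsub hx).1.2 y (hsub hy).1.2
    rw [dist_eq_norm, dist_eq_norm] at this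
    refine this.trans ?_
    gcongr
    have := K₁.coe_nonneg
    linarith

end IsMetricOn

end LocalMetric

/-! ### Reparametrization, dependence on initial velocities, and change of charts -/

/-- A speed function `s` on `[0, 1]` can be made almost constant by a `C¹` change of parameter:
the constant `ε` takes care of the zeros of `s`. -/
lemma exists_reparametrization {s : ℝ → ℝ} (hs : ContinuousOn s (Icc 0 1))
    (hs0 : ∀ t ∈ Icc (0 : ℝ) 1, 0 ≤ s t) {ε : ℝ} (hε : 0 < ε) :
    ∃ τ τ' : ℝ → ℝ, (∀ t, HasDerivAt τ (τ' t) t) ∧ Continuous τ' ∧ τ 0 = 0 ∧ τ 1 = 1 ∧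
      MapsTo τ (Icc 0 1) (Icc 0 1) ∧ (∀ t, 0 ≤ τ' t) ∧
      ∀ t ∈ Icc (0 : ℝ) 1, s (τ t) * τ' t ≤ (∫ x in (0 : ℝ)..1, s x) + ε := by
  set L := ∫ x in (0 : ℝ)..1, s x with hL
  set s₁ : ℝ → ℝ := IccExtend zero_le_one ((Icc (0 : ℝ) 1).domRestrict s) with hs₁
  have hs₁c : Continuous s₁ := hs.domRestrict.Icc_extend'
  have hs₁0 (t : ℝ) : 0 ≤ s₁ t := hs0 _ (projIcc 0 1 zero_le_one t).2
  have hs₁e : ∀ t ∈ Icc (0 : ℝ) 1, s₁ t = s t := fun t ht ↦ IccExtend_of_mem _ _ ht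
  have hL1 : ∫ x in (0 : ℝ)..1, s₁ x = L :=
    intervalIntegral.integral_congr (fun t ht ↦ hs₁e t (by rwa [uIcc_of_le zero_le_one] at ht))
  have hL0 : 0 ≤ L := by
    rw [← hL1]
    exact intervalIntegral.integral_nonneg zero_le_one fun t _ ↦ hs₁0 t
  have hLε : 0 < L + ε := by linarith
  -- the inverse of the change of parameter, with a positive derivative
  set σ : ℝ → ℝ := fun t ↦ (∫ x in (0 : ℝ)..t, (s₁ x + ε)) / (L + ε) with hσ
  have hσ' (t : ℝ) : HasDerivAt σ ((s₁ t + ε) / (L + ε)) t :=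
    (intervalIntegral.integral_hasDerivAt_right
      ((hs₁c.add continuous_const).intervalIntegrable _ _)
      ((hs₁c.add continuous_const).stronglyMeasurableAtFilter _ _)
      (hs₁c.add continuous_const).continuousAt).div_const _
  have hpos (t : ℝ) : 0 < (s₁ t + ε) / (L + ε) := div_pos (by linarith [hs₁0 t]) hLε
  have hmono : StrictMono σ := strictMono_of_deriv_pos fun t ↦ by rw [(hσ' t).deriv]; exact hpos t
  have hσc : Continuous σ := continuous_iff_continuousAt.2 fun t ↦ (hσ' t).continuousAt
  have hσ0 : σ 0 = 0 := by simp [hσ]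
  have hσ1 : σ 1 = 1 := by
    simp only [hσ]
    rw [intervalIntegral.integral_add (hs₁c.intervalIntegrable _ _) (by simp), hL1]
    simp [hLε.ne']
  have hmul (a b : ℝ) (hab : a ≤ b) : ε / (L + ε) * (b - a) ≤ σ b - σ a :=
    Convex.mul_sub_le_image_sub_of_le_deriv convex_univ hσc.continuousOn
      (fun t _ ↦ (hσ' t).differentiableAt.differentiableWithinAt)
      (fun t _ ↦ by rw [(hσ' t).deriv]; gcongr; linarith [hs₁0 t])
      a (mem_univ _) b (mem_univ _) hab
  have hk : 0 < ε / (L + ε) := by positivity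
  have hsurj : Function.Surjective σ := by
    apply hσc.surjective
    · refine Filter.tendsto_atTop_mono' _ ?_ (Filter.tendsto_id.const_mul_atTop hk)
      filter_upwards [Filter.eventually_ge_atTop 0] with t ht
      have := hmul 0 t ht
      simpa [hσ0] using this
    · refine Filter.tendsto_atBot_mono' _ ?_ (Filter.tendsto_id.const_mul_atBot hk)
      filter_upwards [Filter.eventually_le_atBot 0] with t ht
      have := hmul t 0 ht
      simp only [hσ0, id] at this ⊢
      linarith
  set e := hmono.orderIsoOfSurjective σ hsurj with he
  have hστ (t : ℝ) : σ (e.symm t) = t := e.apply_symm_apply t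
  have hτσ (t : ℝ) : e.symm (σ t) = t := e.symm_apply_apply t
  have hτ0 : e.symm 0 = 0 := by rw [← hσ0, hτσ, hσ0]
  have hτ1 : e.symm 1 = 1 := by
    conv_lhs => rw [← hσ1]
    exact hτσ 1
  have hmaps : MapsTo e.symm (Icc 0 1) (Icc 0 1) := fun t ht ↦
    ⟨hτ0 ▸ e.symm.monotone ht.1, hτ1 ▸ e.symm.monotone ht.2⟩
  refine ⟨e.symm, fun t ↦ ((s₁ (e.symm t) + ε) / (L + ε))⁻¹, fun t ↦ ?_, ?_, hτ0, hτ1, hmaps,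
    fun t ↦ (inv_pos.2 (hpos _)).le, fun t ht ↦ ?_⟩
  · exact HasDerivAt.of_local_left_inverse e.symm.continuous.continuousAt (hσ' _)
      (hpos _).ne' (Filter.Eventually.of_forall hστ)
  · exact (((hs₁c.comp e.symm.continuous).add continuous_const).div_const _).inv₀
      fun t ↦ (hpos _).ne'
  · rw [← hs₁e _ (hmaps ht)]
    change s₁ (e.symm t) * ((s₁ (e.symm t) + ε) / (L + ε))⁻¹ ≤ L + ε
    rw [inv_div, ← mul_div_assoc, div_le_iff₀ (by linarith [hs₁0 (e.symm t)])]
    nlinarith [hs₁0 (e.symm t)]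

section LocalMetric

variable {E : Type*} [NormedAddCommGroup E] [NormedSpace ℝ E] [FiniteDimensional ℝ E]

/-- Solutions of the geodesic equation `u'' = - B u (u', u')` starting at the same point with small
velocities: at time `1`, the map from the initial velocity to the endpoint is close to the
identity. -/
lemma norm_endpoint_sub_le {B : E → E →L[ℝ] E →L[ℝ] E} {s : Set E} {K r : ℝ} (hK : 0 ≤ K)
    (hr : 0 ≤ r) (hKr : K * r ^ 2 + 2 * K * r ≤ 1 / 4)
    (hB : ∀ x ∈ s, ‖B x‖ ≤ K) (hB' : ∀ x ∈ s, ∀ y ∈ s, ‖B x - B y‖ ≤ K * ‖x - y‖)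
    {u u' w w' : ℝ → E} (hu : ∀ t ∈ Icc (0 : ℝ) 1, HasDerivAt u (u' t) t)
    (hu' : ∀ t ∈ Icc (0 : ℝ) 1, HasDerivAt u' (- B (u t) (u' t) (u' t)) t)
    (hw : ∀ t ∈ Icc (0 : ℝ) 1, HasDerivAt w (w' t) t)
    (hw' : ∀ t ∈ Icc (0 : ℝ) 1, HasDerivAt w' (- B (w t) (w' t) (w' t)) t)
    (hus : ∀ t ∈ Icc (0 : ℝ) 1, u t ∈ s) (hws : ∀ t ∈ Icc (0 : ℝ) 1, w t ∈ s)
    (hur : ∀ t ∈ Icc (0 : ℝ) 1, ‖u' t‖ ≤ r) (hwr : ∀ t ∈ Icc (0 : ℝ) 1, ‖w' t‖ ≤ r)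
    (h0 : u 0 = w 0) :
    ‖u 1 - w 1 - (u' 0 - w' 0)‖ ≤ 1 / 2 * ‖u' 0 - w' 0‖ := by
  -- `D` is the maximum over time of the deviation of `u' - w'` from its initial value
  set a := u' 0 - w' 0 with ha
  set h : ℝ → E := fun t ↦ u' t - w' t - a with hh
  have hh' : ∀ t ∈ Icc (0 : ℝ) 1, HasDerivAt h
      (- B (u t) (u' t) (u' t) - - B (w t) (w' t) (w' t)) t := fun t ht ↦
    ((hu' t ht).sub (hw' t ht)).sub_const a
  have hcont : ContinuousOn h (Icc 0 1) := fun t ht ↦ (hh' t ht).continuousAt.continuousWithinAt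
  obtain ⟨t₀, ht₀, hmax⟩ := isCompact_Icc.exists_isMaxOn (nonempty_Icc.2 zero_le_one) hcont.norm
  set D := ‖h t₀‖ with hD
  have hle : ∀ t ∈ Icc (0 : ℝ) 1, ‖h t‖ ≤ D := fun t ht ↦ hmax ht
  have hvel : ∀ t ∈ Icc (0 : ℝ) 1, ‖u' t - w' t‖ ≤ D + ‖a‖ := fun t ht ↦ by
    have : u' t - w' t = h t + a := by simp [hh]
    rw [this]
    exact (norm_add_le _ _).trans (by gcongr; exact hle t ht)
  have hD0 : 0 ≤ D + ‖a‖ := by positivity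
  have hpos : ∀ t ∈ Icc (0 : ℝ) 1, ‖u t - w t‖ ≤ D + ‖a‖ := fun t ht ↦ by
    have := norm_image_sub_le_of_norm_deriv_le_segment'
      (f := fun t ↦ u t - w t) (f' := fun t ↦ u' t - w' t) (a := 0) (b := 1) (C := D + ‖a‖)
      (fun t ht ↦ ((hu t ht).sub (hw t ht)).hasDerivWithinAt)
      (fun t ht ↦ hvel t ⟨ht.1, ht.2.le⟩) t ht
    simp only [h0, sub_self, sub_zero] at this
    nlinarith [ht.2]
  have hacc : ∀ t ∈ Icc (0 : ℝ) 1, ‖- B (u t) (u' t) (u' t) - - B (w t) (w' t) (w' t)‖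
      ≤ 1 / 4 * (D + ‖a‖) := fun t ht ↦ by
    have hsplit : - B (u t) (u' t) (u' t) - - B (w t) (w' t) (w' t)
        = -((B (u t) - B (w t)) (u' t) (u' t) + B (w t) (u' t) (u' t - w' t)
          + B (w t) (u' t - w' t) (w' t)) := by
      simp only [sub_apply, map_sub]
      abel
    rw [hsplit, norm_neg]
    have h1 : ‖(B (u t) - B (w t)) (u' t) (u' t)‖ ≤ K * (D + ‖a‖) * r * r := by
      refine ((B (u t) - B (w t)).le_opNorm₂ _ _).trans ?_
      have := (hB' _ (hus t ht) _ (hws t ht)).trans (mul_le_mul_of_nonneg_left (hpos t ht) hK)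
      gcongr
      exacts [hur t ht, hur t ht]
    have h2 : ‖B (w t) (u' t) (u' t - w' t)‖ ≤ K * r * (D + ‖a‖) := by
      refine ((B (w t)).le_opNorm₂ _ _).trans ?_
      gcongr
      exacts [hB _ (hws t ht), hur t ht, hvel t ht]
    have h3 : ‖B (w t) (u' t - w' t) (w' t)‖ ≤ K * (D + ‖a‖) * r := by
      refine ((B (w t)).le_opNorm₂ _ _).trans ?_
      gcongr
      exacts [hB _ (hws t ht), hvel t ht, hwr t ht]
    refine (norm_add₃_le).trans ?_
    nlinarith
  have hD1 : D ≤ 1 / 4 * (D + ‖a‖) := by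
    have := norm_image_sub_le_of_norm_deriv_le_segment' (f := h) (a := 0) (b := 1)
      (fun t ht ↦ (hh' t ht).hasDerivWithinAt) (fun t ht ↦ hacc t ⟨ht.1, ht.2.le⟩) t₀ ht₀
    have h00 : h 0 = 0 := by simp [hh, ha]
    rw [h00, sub_zero, sub_zero] at this
    nlinarith [ht₀.2, ht₀.1]
  have hfin := norm_image_sub_le_of_norm_deriv_le_segment'
    (f := fun t ↦ u t - w t - t • a) (f' := h) (a := 0) (b := 1) (C := D)
    (fun t ht ↦ by
      have := (((hu t ht).sub (hw t ht)).sub ((hasDerivAt_id t).smul_const a)).hasDerivWithinAt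
        (s := Icc 0 1)
      rwa [one_smul] at this)
    (fun t ht ↦ hle t ⟨ht.1, ht.2.le⟩) 1 ⟨zero_le_one, le_rfl⟩
  simp only [h0, sub_self, sub_zero, one_smul, zero_smul, mul_one] at hfin
  linarith

lemma ContDiffAt.deriv_infty {u : ℝ → E} {t : ℝ} (hu : ContDiffAt ℝ ∞ u t) :
    ContDiffAt ℝ ∞ (deriv u) t :=
  (hu.fderiv_right (m := ∞) (by simp)).clm_apply contDiffAt_const

lemma hasDerivAt_bilin_apply {G : E → E →L[ℝ] E →L[ℝ] ℝ} {u v w : ℝ → E} {v' w' : E} {t : ℝ}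
    (hG : DifferentiableAt ℝ G (u t)) (hu : DifferentiableAt ℝ u t) (hv : HasDerivAt v v' t)
    (hw : HasDerivAt w w' t) :
    HasDerivAt (fun s ↦ G (u s) (v s) (w s)) (fderiv ℝ G (u t) (deriv u t) (v t) (w t)
      + G (u t) v' (w t) + G (u t) (v t) w') t := by
  have h1 := hG.hasFDerivAt.comp_hasDerivAt t hu.hasDerivAt
  have h2 := (h1.clm_apply hv).clm_apply hw
  simpa using h2

variable {G : E → E →L[ℝ] E →L[ℝ] ℝ} {U : Set E}

/-- Invariance of the geodesic equation under a local change of coordinates `ψ`. -/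
lemma GeodesicEq.comp {G' : E → E →L[ℝ] E →L[ℝ] ℝ} {ψ : E → E} {u : ℝ → E} {t : ℝ}
    (h : GeodesicEq G u t) (hu : ContDiffAt ℝ ∞ u t) (hψ : ContDiffAt ℝ ∞ ψ (u t))
    (hG : DifferentiableAt ℝ G (u t)) (hG' : DifferentiableAt ℝ G' (ψ (u t)))
    (hsymm : ∀ v w, G' (ψ (u t)) v w = G' (ψ (u t)) w v)
    (hGG' : ∀ᶠ y in 𝓝 (u t), ∀ v w, G y v w = G' (ψ y) (fderiv ℝ ψ y v) (fderiv ℝ ψ y w))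
    (hsurj : Function.Surjective (fderiv ℝ ψ (u t))) :
    GeodesicEq G' (fun s ↦ ψ (u s)) t := by
  set x := u t with hx
  have hψ1 : HasFDerivAt ψ (fderiv ℝ ψ x) x := (hψ.differentiableAt (by simp)).hasFDerivAt
  have hψ2 : HasFDerivAt (fderiv ℝ ψ) (fderiv ℝ (fderiv ℝ ψ) x) x :=
    ((hψ.fderiv_right (m := ∞) (by simp)).differentiableAt (by simp)).hasFDerivAt
  have hu1 : HasDerivAt u (deriv u t) t := (hu.differentiableAt (by simp)).hasDerivAt
  have hu2 : HasDerivAt (deriv u) (deriv (deriv u) t) t :=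
    (hu.deriv_infty.differentiableAt (by simp)).hasDerivAt
  have hsnd : IsSymmSndFDerivAt ℝ ψ x := hψ.isSymmSndFDerivAt (by simpa using ENat.LEInfty.out)
  have hev : ∀ᶠ s in 𝓝 t, HasDerivAt (fun s ↦ ψ (u s)) (fderiv ℝ ψ (u s) (deriv u s)) s := by
    filter_upwards [hu.continuousAt.eventually ((hψ.of_le (m := 1) (by simp)).eventually (by simp)),
      (hu.of_le (m := 1) (by simp)).eventually (by simp)] with s h1 h2
    exact ((h1.differentiableAt one_ne_zero).hasFDerivAt.comp_hasDerivAt s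
      (h2.differentiableAt one_ne_zero).hasDerivAt)
  have hd1 : deriv (fun s ↦ ψ (u s)) =ᶠ[𝓝 t] fun s ↦ fderiv ℝ ψ (u s) (deriv u s) :=
    hev.mono fun s hs ↦ hs.deriv
  have hd2 : deriv (deriv (fun s ↦ ψ (u s))) t
      = fderiv ℝ (fderiv ℝ ψ) x (deriv u t) (deriv u t) + fderiv ℝ ψ x (deriv (deriv u) t) := by
    rw [hd1.deriv_eq]
    exact ((hψ2.comp_hasDerivAt t hu1).clm_apply hu2).deriv
  have hGd (z v w : E) : fderiv ℝ G x z v w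
      = fderiv ℝ G' (ψ x) (fderiv ℝ ψ x z) (fderiv ℝ ψ x v) (fderiv ℝ ψ x w)
        + G' (ψ x) (fderiv ℝ (fderiv ℝ ψ) x z v) (fderiv ℝ ψ x w)
        + G' (ψ x) (fderiv ℝ ψ x v) (fderiv ℝ (fderiv ℝ ψ) x z w) := by
    have e1 : HasFDerivAt (fun y ↦ G y v w) _ x :=
      (hG.hasFDerivAt.clm_apply (hasFDerivAt_const v x)).clm_apply (hasFDerivAt_const w x)
    have e2 : HasFDerivAt (fun y ↦ G' (ψ y) (fderiv ℝ ψ y v) (fderiv ℝ ψ y w)) _ x :=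
      ((hG'.hasFDerivAt.comp x hψ1).clm_apply (hψ2.clm_apply (hasFDerivAt_const v x))).clm_apply
        (hψ2.clm_apply (hasFDerivAt_const w x))
    have e3 := (e1.congr_of_eventuallyEq (hGG'.mono fun y hy ↦ (hy v w).symm)).unique e2
    have e4 := congr($e3 z)
    simp at e4
    rw [e4]
    ring
  intro z'
  obtain ⟨z, rfl⟩ := hsurj z'
  have hz := h z
  rw [christoffelForm_apply] at hz ⊢
  simp only [← hx] at hz ⊢
  rw [hd2, hd1.self_of_nhds]
  simp only [← hx]
  rw [hGG'.self_of_nhds, hGd, hGd] at hz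
  -- by the symmetry of the second derivative of `ψ`, the two terms with `ψ''` in the derivative of
  -- the metric along `z` and along `u'` cancel, up to the one that comes from `(ψ ∘ u)''`
  rw [hsnd z (deriv u t)] at hz
  rw [hsymm _ (fderiv ℝ ψ x (deriv u t))] at hz
  rw [hsymm (fderiv ℝ ψ x (deriv u t)) (fderiv ℝ (fderiv ℝ ψ) x (deriv u t) z)] at hz
  simp only [map_add, add_apply]
  linarith

end LocalMetric

/-! ### Geodesics minimize the energy locally -/

section LocalMetric

variable {E : Type*} [NormedAddCommGroup E] [NormedSpace ℝ E] [FiniteDimensional ℝ E]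
  {G : E → E →L[ℝ] E →L[ℝ] ℝ} {U : Set E}

namespace IsMetricOn

lemma norm_sub_taylor_le (hG : IsMetricOn G U) {s : Set E} (hs : s ⊆ U) (hconv : Convex ℝ s) {C : ℝ}
    (hC : 0 ≤ C) (hDG : ∀ x ∈ s, ∀ y ∈ s, ‖fderiv ℝ G x - fderiv ℝ G y‖ ≤ C * ‖x - y‖)
    {x y : E} (hx : x ∈ s) (hy : y ∈ s) :
    ‖G y - G x - fderiv ℝ G x (y - x)‖ ≤ C * ‖y - x‖ ^ 2 := by
  have hseg : segment ℝ x y ⊆ s := hconv.segment_subset hx hy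
  have := (convex_segment x y).norm_image_sub_le_of_norm_hasFDerivWithin_le'
    (f := G) (f' := fderiv ℝ G) (φ := fderiv ℝ G x) (C := C * ‖y - x‖)
    (fun z hz ↦ (hG.hasFDerivAt (hs (hseg hz))).hasFDerivWithinAt)
    (fun z hz ↦ (hDG z (hseg hz) x hx).trans (by
      gcongr
      exact norm_sub_le_of_mem_segment hz))
    (left_mem_segment ℝ x y) (right_mem_segment ℝ x y)
  calc _ ≤ C * ‖y - x‖ * ‖y - x‖ := this
    _ = _ := by ring

/-- Pointwise comparison of the energy densities of two curves `u` and `v = u + η`, with velocities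
`a` and `a + b`: up to the first variation, the difference is bounded below by a quadratic form in
`η` and `b` that is coercive in `b`. -/
lemma energyDensity_sub_ge (hG : IsMetricOn G U) {s : Set E} (hs : s ⊆ U) (hconv : Convex ℝ s)
    {c C r : ℝ} (hC : 0 ≤ C) (hr : 0 ≤ r) (hc : ∀ x ∈ s, ∀ v, c * ‖v‖ ^ 2 ≤ G x v v)
    (hLip : ∀ x ∈ s, ∀ y ∈ s, ‖G x - G y‖ ≤ C * ‖x - y‖)
    (hDG : ∀ x ∈ s, ∀ y ∈ s, ‖fderiv ℝ G x - fderiv ℝ G y‖ ≤ C * ‖x - y‖)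
    {x y : E} (hx : x ∈ s) (hy : y ∈ s) {a b : E} (ha : ‖a‖ ≤ r) {N : ℝ} (hN : ‖y - x‖ ≤ N) :
    (c - C * r) * ‖b‖ ^ 2 - (C * r ^ 2 + C * r) * N ^ 2 ≤
      G y (a + b) (a + b) - G x a a - 2 * ((1 / 2) * fderiv ℝ G x (y - x) a a + G x a b) := by
  have hN0 : 0 ≤ N := (norm_nonneg _).trans hN
  have h1 : |(G y - G x - fderiv ℝ G x (y - x)) a a| ≤ C * N ^ 2 * r * r := by
    refine ((G y - G x - fderiv ℝ G x (y - x)).le_opNorm₂ a a).trans ?_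
    have := (hG.norm_sub_taylor_le hs hconv hC hDG hx hy).trans
      (show C * ‖y - x‖ ^ 2 ≤ C * N ^ 2 by gcongr)
    gcongr
  have h2 : |(G y - G x) a b| ≤ C * N * r * ‖b‖ := by
    refine ((G y - G x).le_opNorm₂ a b).trans ?_
    have := (hLip y hy x hx).trans (show C * ‖y - x‖ ≤ C * N by gcongr)
    gcongr
  have h3 := hc y hy b
  have h4 : G y (a + b) (a + b) = G y a a + 2 * G y a b + G y b b := by
    simp only [map_add, add_apply]
    rw [hG.symm y b a]
    ring
  simp only [sub_apply] at h1 h2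
  have h5 : 2 * N * ‖b‖ ≤ N ^ 2 + ‖b‖ ^ 2 := two_mul_le_add_sq N ‖b‖
  have h6 : C * r * (2 * N * ‖b‖) ≤ C * r * (N ^ 2 + ‖b‖ ^ 2) := by gcongr
  rw [h4]
  nlinarith [(abs_le.1 h1).1, (abs_le.1 h2).1]

/-- A geodesic that is short and slow (in a chart) minimizes the energy among the curves with the
same endpoints: the first variation of the energy vanishes, and the remaining terms are nonnegative
by the Poincaré inequality. -/
lemma exists_energy_le (hG : IsMetricOn G U) {x₀ : E} (hx₀ : x₀ ∈ U) :
    ∃ ρ > 0, ∃ r > 0, Metric.closedBall x₀ ρ ⊆ U ∧ ∀ u u' u'' v v' : ℝ → E,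
      (∀ t ∈ Icc (0 : ℝ) 1, HasDerivAt u (u' t) t) →
      (∀ t ∈ Icc (0 : ℝ) 1, HasDerivAt u' (u'' t) t) →
      (∀ t ∈ Icc (0 : ℝ) 1, ∀ z, G (u t) (u'' t) z
        + christoffelForm G (u t) (u' t) (u' t) z = 0) →
      (∀ t ∈ Icc (0 : ℝ) 1, HasDerivAt v (v' t) t) → ContinuousOn v' (Icc 0 1) →
      (∀ t ∈ Icc (0 : ℝ) 1, u t ∈ Metric.closedBall x₀ ρ) →
      (∀ t ∈ Icc (0 : ℝ) 1, v t ∈ Metric.closedBall x₀ ρ) →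
      (∀ t ∈ Icc (0 : ℝ) 1, ‖u' t‖ ≤ r) → u 0 = v 0 → u 1 = v 1 →
      ∫ t in (0 : ℝ)..1, G (u t) (u' t) (u' t) ≤ ∫ t in (0 : ℝ)..1, G (v t) (v' t) (v' t) := by
  obtain ⟨ρ, hρ, c, hc, C, hC, hsub, hcG, hLip, hDG⟩ := hG.exists_bounds hx₀
  -- with `3 * C * r ≤ c`, the coercive term `c * ‖b‖ ^ 2` absorbs the error terms
  refine ⟨ρ, hρ, min 1 (c / (3 * C)), by positivity, hsub, ?_⟩
  intro u u' u'' v v' hu hu' heq hv hv' hus hvs hur h0 h1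
  set r := min 1 (c / (3 * C)) with hr
  have hr0 : 0 < r := by positivity
  have hr1 : r ≤ 1 := min_le_left _ _
  have hr2 : 3 * (C * r) ≤ c := by
    have : r ≤ c / (3 * C) := min_le_right _ _
    rw [le_div_iff₀ (by positivity)] at this
    linarith
  have I01 : uIcc (0 : ℝ) 1 = Icc 0 1 := uIcc_of_le zero_le_one
  have huc : ContinuousOn u (Icc 0 1) := fun t ht ↦ (hu t ht).continuousAt.continuousWithinAt
  have hu'c : ContinuousOn u' (Icc 0 1) := fun t ht ↦ (hu' t ht).continuousAt.continuousWithinAt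
  have hvc : ContinuousOn v (Icc 0 1) := fun t ht ↦ (hv t ht).continuousAt.continuousWithinAt
  have hGc : ContinuousOn G U := hG.contDiffOn.continuousOn
  have hDGc : ContinuousOn (fderiv ℝ G) U := fun x hx ↦
    (hG.contDiffAt_fderiv hx).continuousAt.continuousWithinAt
  have hGu : ContinuousOn (fun t ↦ G (u t)) (Icc 0 1) := hGc.comp huc fun t ht ↦ hsub (hus t ht)
  have hGv : ContinuousOn (fun t ↦ G (v t)) (Icc 0 1) := hGc.comp hvc fun t ht ↦ hsub (hvs t ht)
  have hDGu : ContinuousOn (fun t ↦ fderiv ℝ G (u t)) (Icc 0 1) :=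
    hDGc.comp huc fun t ht ↦ hsub (hus t ht)
  set b : ℝ → E := fun t ↦ v' t - u' t with hb
  have hbc : ContinuousOn b (Icc 0 1) := hv'.sub hu'c
  have hEu : ContinuousOn (fun t ↦ G (u t) (u' t) (u' t)) (uIcc 0 1) := by
    rw [I01]
    exact (hGu.clm_apply hu'c).clm_apply hu'c
  have hEv : ContinuousOn (fun t ↦ G (v t) (v' t) (v' t)) (uIcc 0 1) := by
    rw [I01]
    exact (hGv.clm_apply hv').clm_apply hv'
  have hF : ContinuousOn (fun t ↦ (1 / 2) * fderiv ℝ G (u t) (v t - u t) (u' t) (u' t)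
      + G (u t) (u' t) (b t)) (uIcc 0 1) := by
    rw [I01]
    exact (continuousOn_const.mul
      (((hDGu.clm_apply (hvc.sub huc)).clm_apply hu'c).clm_apply hu'c)).add
      ((hGu.clm_apply hu'c).clm_apply hbc)
  -- the first variation vanishes: by the geodesic equation, its integrand is the derivative of
  -- the boundary term `G (u) (u', v - u)`, which is zero at both endpoints
  have hfirst : ∫ t in (0 : ℝ)..1, ((1 / 2) * fderiv ℝ G (u t) (v t - u t) (u' t) (u' t)
      + G (u t) (u' t) (b t)) = 0 := by
    have hder : ∀ t ∈ uIcc (0 : ℝ) 1, HasDerivAt (fun t ↦ G (u t) (u' t) (v t - u t))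
        ((1 / 2) * fderiv ℝ G (u t) (v t - u t) (u' t) (u' t) + G (u t) (u' t) (b t)) t := by
      intro t ht
      rw [I01] at ht
      have hGd : DifferentiableAt ℝ G (u t) :=
        (hG.hasFDerivAt (hsub (hus t ht))).differentiableAt
      have := hasDerivAt_bilin_apply hGd (hu t ht).differentiableAt (hu' t ht)
        ((hv t ht).sub (hu t ht))
      refine this.congr_deriv ?_
      have h2 := heq t ht (v t - u t)
      rw [christoffelForm_apply] at h2
      rw [(hu t ht).deriv]
      simp only [hb, Pi.sub_apply]
      linarith
    rw [intervalIntegral.integral_eq_sub_of_hasDerivAt hder]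
    · simp [h0, h1]
    · exact hF.intervalIntegrable
  set N := ∫ t in (0 : ℝ)..1, ‖b t‖ with hN
  have hbn : ContinuousOn (fun t ↦ ‖b t‖) (uIcc 0 1) := by rw [I01]; exact hbc.norm
  have hη : ∀ t ∈ Icc (0 : ℝ) 1, ‖v t - u t‖ ≤ N := by
    intro t ht
    have hsubt : uIcc 0 t ⊆ Icc 0 1 := by
      rw [uIcc_of_le ht.1]
      exact Icc_subset_Icc_right ht.2
    have e1 : ∫ s in (0 : ℝ)..t, b s = v t - u t := by
      rw [intervalIntegral.integral_eq_sub_of_hasDerivAt (f := fun s ↦ v s - u s)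
        (fun s hs ↦ (hv s (hsubt hs)).sub (hu s (hsubt hs)))
        (ContinuousOn.intervalIntegrable (hbc.mono hsubt))]
      simp [h0]
    rw [← e1]
    refine (intervalIntegral.norm_integral_le_integral_norm ht.1).trans ?_
    exact intervalIntegral.integral_mono_interval le_rfl ht.1 ht.2
      (Filter.Eventually.of_forall fun _ ↦ norm_nonneg _) hbn.intervalIntegrable
  have hb2 : ContinuousOn (fun t ↦ ‖b t‖ ^ 2) (uIcc 0 1) := hbn.pow 2
  -- the Cauchy-Schwarz inequality: the variation `v - u`, bounded by `N`, is controlled by its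
  -- derivative `b`, which gives the Poincaré inequality
  have hCS : N ^ 2 ≤ ∫ t in (0 : ℝ)..1, ‖b t‖ ^ 2 := by
    have e1 : 0 ≤ ∫ t in (0 : ℝ)..1, (‖b t‖ ^ 2 - (2 * N * ‖b t‖ - N ^ 2)) :=
      intervalIntegral.integral_nonneg zero_le_one fun t _ ↦ by nlinarith [sq_nonneg (‖b t‖ - N)]
    have e2 : IntervalIntegrable (fun t ↦ 2 * N * ‖b t‖) MeasureTheory.volume 0 1 :=
      hbn.intervalIntegrable.const_mul _
    rw [intervalIntegral.integral_sub hb2.intervalIntegrable (e2.sub (by simp)),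
      intervalIntegral.integral_sub e2 (by simp),
      intervalIntegral.integral_const_mul, ← hN] at e1
    simp at e1
    nlinarith
  have hmain : ∫ t in (0 : ℝ)..1, ((c - C * r) * ‖b t‖ ^ 2 - (C * r ^ 2 + C * r) * N ^ 2) ≤
      ∫ t in (0 : ℝ)..1, (G (v t) (v' t) (v' t) - G (u t) (u' t) (u' t)
        - 2 * ((1 / 2) * fderiv ℝ G (u t) (v t - u t) (u' t) (u' t) + G (u t) (u' t) (b t))) := by
    refine intervalIntegral.integral_mono_on zero_le_one
      ((continuousOn_const.mul hb2).sub continuousOn_const).intervalIntegrable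
      ((hEv.sub hEu).sub (continuousOn_const.mul hF)).intervalIntegrable fun t ht ↦ ?_
    have := hG.energyDensity_sub_ge hsub (convex_closedBall x₀ ρ) hC.le hr0.le hcG hLip hDG
      (hus t ht) (hvs t ht) (a := u' t) (b := b t) (hur t ht) (hη t ht)
    simpa [hb] using this
  rw [intervalIntegral.integral_sub
      (hEv.intervalIntegrable.sub hEu.intervalIntegrable) (hF.intervalIntegrable.const_mul 2),
    intervalIntegral.integral_sub hEv.intervalIntegrable hEu.intervalIntegrable,
    intervalIntegral.integral_const_mul, hfirst,
    intervalIntegral.integral_sub (hb2.intervalIntegrable.const_mul _) (by simp),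
    intervalIntegral.integral_const_mul] at hmain
  simp only [intervalIntegral.integral_const, sub_zero, one_smul, mul_zero] at hmain
  have hCr : C * r ^ 2 ≤ C * r := by nlinarith [mul_pos hC hr0]
  have hS : (c - C * r) * N ^ 2 ≤ (c - C * r) * ∫ t in (0 : ℝ)..1, ‖b t‖ ^ 2 := by
    apply mul_le_mul_of_nonneg_left hCS
    nlinarith [mul_pos hC hr0]
  nlinarith [sq_nonneg N]

end IsMetricOn

end LocalMetric

/-! ### Geodesics on manifolds: local existence, uniqueness, constant speed -/

section LocalMetric

variable {E : Type*} [NormedAddCommGroup E] [NormedSpace ℝ E] [FiniteDimensional ℝ E]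
  {G : E → E →L[ℝ] E →L[ℝ] ℝ} {U : Set E}

lemma GeodesicEq.congr {u w : ℝ → E} {t : ℝ} (h : GeodesicEq G u t) (huw : u =ᶠ[𝓝 t] w) :
    GeodesicEq G w t := by
  intro z
  rw [← huw.self_of_nhds, ← huw.deriv_eq, ← huw.deriv.deriv_eq]
  exact h z

lemma deriv_comp_affine (f : ℝ → E) (a b t : ℝ) :
    deriv (fun s ↦ f (a * s + b)) t = a • deriv f (a * t + b) := by
  rw [deriv_comp_mul_left a (fun y ↦ f (y + b)) t, deriv_comp_add_const]

lemma GeodesicEq.comp_affine {u : ℝ → E} {a b t : ℝ} (h : GeodesicEq G u (a * t + b)) :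
    GeodesicEq G (fun s ↦ u (a * s + b)) t := by
  intro z
  have h1 : deriv (fun s ↦ u (a * s + b)) = fun t ↦ a • deriv u (a * t + b) :=
    funext fun t ↦ deriv_comp_affine u a b t
  have h2 : deriv (deriv (fun s ↦ u (a * s + b))) t = a • a • deriv (deriv u) (a * t + b) := by
    rw [h1, deriv_comp_affine (fun y ↦ a • deriv u y) a b t]
    congr 1
    exact deriv_const_smul_field a (deriv u)
  rw [h2, h1]
  have := h z
  simp only [map_smul, smul_apply, smul_eq_mul]
  linear_combination a ^ 2 * this

/-- The vector field on the tangent bundle of a vector space whose integral curves are the pairs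
`(u, u')` with `u` a geodesic. -/
def geodesicField (G : E → E →L[ℝ] E →L[ℝ] ℝ) (z : E × E) : E × E :=
  (z.2, - connectionForm G z.1 z.2 z.2)

namespace IsMetricOn

lemma contDiffAt_geodesicField (hG : IsMetricOn G U) {z : E × E} (hz : z.1 ∈ U) :
    ContDiffAt ℝ ∞ (geodesicField G) z := by
  have h1 : ContDiffAt ℝ ∞ (fun z : E × E ↦ connectionForm G z.1) z :=
    (hG.contDiffAt_connectionForm hz).comp z contDiffAt_fst
  exact contDiffAt_snd.prodMk ((h1.clm_apply contDiffAt_snd).clm_apply contDiffAt_snd).neg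

lemma hasDerivAt_geodesicField (hG : IsMetricOn G U) {u : ℝ → E} {t : ℝ} (hu : ContDiffAt ℝ ∞ u t)
    (hut : u t ∈ U) (h : GeodesicEq G u t) :
    HasDerivAt (fun s ↦ (u s, deriv u s)) (geodesicField G (u t, deriv u t)) t := by
  have h1 := (hu.differentiableAt (by simp)).hasDerivAt
  have h2 := (hu.deriv_infty.differentiableAt (by simp)).hasDerivAt
  rw [(hG.geodesicEq_iff hut).1 h] at h2
  exact h1.prodMk h2

/-- A geodesic is determined near a time by its position and velocity at this time. -/
lemma geodesic_unique (hG : IsMetricOn G U) {u w : ℝ → E} {t : ℝ} (hut : u t ∈ U)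
    (hu : ∀ᶠ s in 𝓝 t, ContDiffAt ℝ ∞ u s ∧ GeodesicEq G u s)
    (hw : ∀ᶠ s in 𝓝 t, ContDiffAt ℝ ∞ w s ∧ GeodesicEq G w s)
    (h0 : u t = w t) (h1 : deriv u t = deriv w t) : u =ᶠ[𝓝 t] w := by
  obtain ⟨K, s, hs, hK⟩ := ((hG.contDiffAt_geodesicField (z := (u t, deriv u t)) hut).of_le
    (by simp)).exists_lipschitzOnWith
  have key {v : ℝ → E} (hv : ∀ᶠ s in 𝓝 t, ContDiffAt ℝ ∞ v s ∧ GeodesicEq G v s)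
      (hv0 : v t = u t) (hv1 : deriv v t = deriv u t) :
      ∀ᶠ y in 𝓝 t, HasDerivAt (fun s ↦ (v s, deriv v s))
        (geodesicField G (v y, deriv v y)) y ∧ (v y, deriv v y) ∈ s := by
    have hc : ContinuousAt v t := hv.self_of_nhds.1.continuousAt
    have hc' : ContinuousAt (deriv v) t := hv.self_of_nhds.1.deriv_infty.continuousAt
    filter_upwards [hv, hc (hG.isOpen.mem_nhds (by rwa [hv0])),
      (hc.prodMk hc') (show s ∈ 𝓝 (v t, deriv v t) by rwa [hv0, hv1])] with y hy hyU hys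
    exact ⟨hG.hasDerivAt_geodesicField hy.1 hyU hy.2, hys⟩
  have := ODE_solution_unique_of_eventually (v := fun _ ↦ geodesicField G) (s := fun _ ↦ s)
    (Filter.Eventually.of_forall fun _ ↦ hK) (key hu rfl rfl) (key hw h0.symm h1.symm)
    (by rw [h0, h1])
  exact this.mono fun y hy ↦ congr_arg Prod.fst hy

/-- Geodesics exist on a uniform time interval for all initial conditions near a point with small
velocity. -/
lemma exists_geodesic (hG : IsMetricOn G U) {x₀ : E} (hx₀ : x₀ ∈ U) :
    ∃ r > 0, ∃ ε > 0, ∀ x v, ‖x - x₀‖ ≤ r → ‖v‖ ≤ r → ∃ u : ℝ → E, u 0 = x ∧ deriv u 0 = v ∧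
      ∀ t ∈ Ioo (-ε) ε, u t ∈ U ∧ ContDiffAt ℝ ∞ u t ∧ GeodesicEq G u t := by
  have hF := hG.contDiffAt_geodesicField (z := (x₀, 0)) hx₀
  obtain ⟨ε, hε, a, r, L, K, hr, hPL⟩ := IsPicardLindelof.of_contDiffAt_one (hF.of_le (by simp))
  obtain ⟨α, hα, hαc⟩ :=
    (hPL 0).exists_forall_mem_closedBall_eq_hasDerivWithinAt_continuousOn
  simp only [zero_sub, zero_add] at hα hαc
  have hr' : (0 : ℝ) < r := hr
  have hmem : ((x₀, (0 : E)), (0 : ℝ)) ∈ Metric.closedBall (x₀, (0 : E)) r ×ˢ Icc (-ε) ε :=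
    ⟨Metric.mem_closedBall_self hr'.le, by constructor <;> linarith⟩
  have hnhds : Metric.closedBall (x₀, (0 : E)) r ×ˢ Icc (-ε) ε ∈ 𝓝 ((x₀, (0 : E)), (0 : ℝ)) :=
    prod_mem_nhds (Metric.closedBall_mem_nhds _ hr') (Icc_mem_nhds (by linarith) hε)
  have hcont : ContinuousAt α ((x₀, (0 : E)), (0 : ℝ)) := hαc.continuousAt hnhds
  have hV : α ⁻¹' (U ×ˢ univ) ∈ 𝓝 ((x₀, (0 : E)), (0 : ℝ)) := by
    refine hcont ((hG.isOpen.prod isOpen_univ).mem_nhds ?_)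
    rw [(hα _ hmem.1).1]
    exact ⟨hx₀, mem_univ _⟩
  obtain ⟨δ, hδ, hδV⟩ := Metric.nhds_basis_closedBall.mem_iff.1 (Filter.inter_mem hnhds hV)
  refine ⟨δ, hδ, δ, hδ, fun x v hx hv ↦ ?_⟩
  have hball : ∀ t ∈ Icc (-δ) δ, ((x, v), t) ∈ Metric.closedBall ((x₀, (0 : E)), (0 : ℝ)) δ := by
    intro t ht
    rw [← closedBall_prod_same, ← closedBall_prod_same]
    refine ⟨⟨mem_closedBall_iff_norm.2 hx, ?_⟩, ?_⟩
    · simpa using hv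
    · simpa using abs_le.2 ht
  set β : ℝ → E × E := fun t ↦ α ((x, v), t) with hβ
  have h00 : (0 : ℝ) ∈ Ioo (-δ) δ := ⟨by linarith, hδ⟩
  have hxv : (x, v) ∈ Metric.closedBall (x₀, (0 : E)) r :=
    (hδV (hball 0 (Ioo_subset_Icc_self h00))).1.1
  have hβU : ∀ t ∈ Icc (-δ) δ, (β t).1 ∈ U := fun t ht ↦ (hδV (hball t ht)).2.1
  have hsub : Icc (-δ) δ ⊆ Icc (-ε) ε := fun t ht ↦ (hδV (hball t ht)).1.2
  have hβW : ∀ t ∈ Icc (-δ) δ, HasDerivWithinAt β (geodesicField G (β t)) (Icc (-δ) δ) t :=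
    fun t ht ↦ ((hα _ hxv).2 t (hsub ht)).mono hsub
  have hβd : ∀ t ∈ Ioo (-δ) δ, HasDerivAt β (geodesicField G (β t)) t := fun t ht ↦
    (hβW t (Ioo_subset_Icc_self ht)).hasDerivAt (Icc_mem_nhds ht.1 ht.2)
  have hβs : ContDiffOn ℝ ∞ β (Icc (-δ) δ) := by
    refine ODE.contDiffOn_enat_Icc_of_hasDerivWithinAt (f := fun _ ↦ geodesicField G)
      (u := U ×ˢ univ) (n := ⊤) ?_ hβW (fun t ht ↦ ⟨hβU t ht, mem_univ _⟩)
    rintro ⟨t, z⟩ ⟨-, hz⟩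
    exact ((hG.contDiffAt_geodesicField hz.1).comp (t, z) contDiffAt_snd).contDiffWithinAt
  have hd : ∀ t ∈ Ioo (-δ) δ, deriv (fun s ↦ (β s).1) t = (β t).2 := fun t ht ↦
    ((hasFDerivAt_fst (p := β t)).comp_hasDerivAt t (hβd t ht)).deriv
  have hβ0 : β 0 = (x, v) := (hα _ hxv).1
  refine ⟨fun t ↦ (β t).1, by simp [hβ0], by rw [hd 0 h00, hβ0], fun t ht ↦
    ⟨hβU t (Ioo_subset_Icc_self ht), ?_, ?_⟩⟩
  · exact (hβs.contDiffAt (Icc_mem_nhds ht.1 ht.2)).fst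
  · rw [hG.geodesicEq_iff (u := fun t ↦ (β t).1) (hβU t (Ioo_subset_Icc_self ht)), hd t ht]
    have : deriv (fun s ↦ (β s).1) =ᶠ[𝓝 t] fun s ↦ (β s).2 := by
      filter_upwards [Ioo_mem_nhds ht.1 ht.2] with s hs using hd s hs
    rw [this.deriv_eq]
    exact ((hasFDerivAt_snd (p := β t)).comp_hasDerivAt t (hβd t ht)).deriv

/-- The energy density is constant along geodesics. -/
lemma hasDerivAt_energyDensity (hG : IsMetricOn G U) {u : ℝ → E} {t : ℝ} (hu : ContDiffAt ℝ ∞ u t)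
    (hut : u t ∈ U) (h : GeodesicEq G u t) :
    HasDerivAt (fun s ↦ G (u s) (deriv u s) (deriv u s)) 0 t := by
  have h2 := (hu.deriv_infty.differentiableAt (by simp)).hasDerivAt
  have := hasDerivAt_bilin_apply (hG.hasFDerivAt hut).differentiableAt
    (hu.differentiableAt (by simp)) h2 h2
  refine this.congr_deriv ?_
  have h3 := h (deriv u t)
  rw [christoffelForm_apply] at h3
  rw [hG.symm _ (deriv u t)]
  linarith

end IsMetricOn

end LocalMetric

section Manifold

variable {E : Type*} [NormedAddCommGroup E] [NormedSpace ℝ E] [FiniteDimensional ℝ E]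
  {M : Type*} [TopologicalSpace M] [ChartedSpace E M] [IsManifold 𝓘(ℝ, E) ∞ M]

lemma contDiffAt_chartCurve {p : M} {γ : ℝ → M} {t : ℝ}
    (hγ : ContMDiffAt 𝓘(ℝ, ℝ) 𝓘(ℝ, E) ∞ γ t) (ht : γ t ∈ (extChartAt 𝓘(ℝ, E) p).source) :
    ContDiffAt ℝ ∞ (chartCurve E p γ) t := by
  rw [← contMDiffAt_iff_contDiffAt]
  exact (contMDiffAt_extChartAt' (by simpa using ht)).comp t hγ

lemma chartCurve_mem_target {p : M} {γ : ℝ → M} {t : ℝ}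
    (ht : γ t ∈ (extChartAt 𝓘(ℝ, E) p).source) :
    chartCurve E p γ t ∈ (extChartAt 𝓘(ℝ, E) p).target :=
  (extChartAt 𝓘(ℝ, E) p).map_source ht

variable [RiemannianBundle (fun x : M ↦ TangentSpace 𝓘(ℝ, E) x)]

variable (E) in
/-- A curve is a geodesic at time `t` if it is smooth at `t` and satisfies the geodesic equation
at `t` in all the preferred charts around the point `γ t`. This is the pointwise version of
`IsGeodesic`, for curves that are geodesics on a part of `ℝ` only. -/
structure IsGeodesicAt (γ : ℝ → M) (t : ℝ) : Prop where
  smooth : ContMDiffAt 𝓘(ℝ, ℝ) 𝓘(ℝ, E) ∞ γ t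
  equation : ∀ p : M, γ t ∈ (extChartAt 𝓘(ℝ, E) p).source →
    GeodesicEq (chartForm p) (chartCurve E p γ) t

lemma IsGeodesicAt.congr {γ σ : ℝ → M} {t : ℝ} (h : IsGeodesicAt E γ t) (hγσ : γ =ᶠ[𝓝 t] σ) :
    IsGeodesicAt E σ t where
  smooth := h.smooth.congr_of_eventuallyEq hγσ.symm
  equation p hp := (h.equation p (by rwa [hγσ.self_of_nhds])).congr
    (hγσ.mono fun s hs ↦ by simp only [chartCurve, hs])

lemma IsGeodesicAt.comp_affine {γ : ℝ → M} {a b t : ℝ} (h : IsGeodesicAt E γ (a * t + b)) :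
    IsGeodesicAt E (fun s ↦ γ (a * s + b)) t where
  smooth := by
    refine ContMDiffAt.comp t h.smooth (ContDiff.contMDiff ?_).contMDiffAt
    fun_prop
  equation p hp := (h.equation p hp).comp_affine (a := a) (b := b)

variable [IsContMDiffRiemannianBundle 𝓘(ℝ, E) ∞ E (fun x : M ↦ TangentSpace 𝓘(ℝ, E) x)]

lemma isMetricOn_chartForm (p : M) :
    IsMetricOn (chartForm p) (extChartAt 𝓘(ℝ, E) p).target where
  isOpen := isOpen_extChartAt_target p
  contDiffOn := contDiffOn_chartForm p
  symm := chartForm_symm p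
  pos _ hx _ hv := chartForm_pos hx hv

lemma isGeodesic_iff {γ : ℝ → M} : IsGeodesic E γ ↔ ∀ t, IsGeodesicAt E γ t := by
  have key {p : M} {t : ℝ} (ht : γ t ∈ (extChartAt 𝓘(ℝ, E) p).source) (v z : E) :
      christoffelFirst E p (chartCurve E p γ t) v v z
        = christoffelForm (chartForm p) (chartCurve E p γ t) v v z := by
    rw [christoffelFirst_eq (chartCurve_mem_target ht), christoffelForm_apply]
    ring
  constructor
  · intro h t
    refine ⟨h.smooth t, fun p hp z ↦ ?_⟩
    rw [← key hp]
    exact h.equation p t hp z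
  · intro h
    refine ⟨fun t ↦ (h t).smooth, fun p t hp z ↦ ?_⟩
    have := (h t).equation p hp z
    rw [← key hp] at this
    exact this

lemma hasFDerivAt_transition {p q : M} {y : E} (hy : y ∈ (extChartAt 𝓘(ℝ, E) p).target)
    (hq : (extChartAt 𝓘(ℝ, E) p).symm y ∈ (extChartAt 𝓘(ℝ, E) q).source) :
    HasFDerivAt (fun y ↦ extChartAt 𝓘(ℝ, E) q ((extChartAt 𝓘(ℝ, E) p).symm y))
      ((chartDeriv q ((extChartAt 𝓘(ℝ, E) p).symm y)).comp (chartSymmDeriv p y)) y :=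
  ((mdifferentiableAt_extChartAt (I := 𝓘(ℝ, E)) (by simpa using hq)).hasMFDerivAt.comp y
    (mdifferentiableAt_extChartAt_symm hy).hasMFDerivAt).hasFDerivAt

/-- It suffices to check the geodesic equation in one chart. -/
lemma IsGeodesicAt.of_chart {γ : ℝ → M} {t : ℝ} {p : M}
    (hγ : ContMDiffAt 𝓘(ℝ, ℝ) 𝓘(ℝ, E) ∞ γ t) (hp : γ t ∈ (extChartAt 𝓘(ℝ, E) p).source)
    (h : GeodesicEq (chartForm p) (chartCurve E p γ) t) : IsGeodesicAt E γ t := by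
  refine ⟨hγ, fun q hq ↦ ?_⟩
  have hx := chartCurve_mem_target hp
  have hinv : (extChartAt 𝓘(ℝ, E) p).symm (chartCurve E p γ t) = γ t :=
    (extChartAt 𝓘(ℝ, E) p).left_inv hp
  have hq' : (extChartAt 𝓘(ℝ, E) p).symm (chartCurve E p γ t) ∈ (extChartAt 𝓘(ℝ, E) q).source := by
    rwa [hinv]
  have hψx : extChartAt 𝓘(ℝ, E) q ((extChartAt 𝓘(ℝ, E) p).symm (chartCurve E p γ t))
      ∈ (extChartAt 𝓘(ℝ, E) q).target := (extChartAt 𝓘(ℝ, E) q).map_source hq'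
  have hψ : ContDiffAt ℝ ∞ (fun y ↦ extChartAt 𝓘(ℝ, E) q ((extChartAt 𝓘(ℝ, E) p).symm y))
      (chartCurve E p γ t) := by
    rw [← contMDiffAt_iff_contDiffAt]
    exact (contMDiffAt_extChartAt' (by simpa using hq')).comp _ (contMDiffAt_extChartAt_symm hx)
  have hd := hasFDerivAt_transition hx hq'
  have hcomp : GeodesicEq (chartForm q) (fun s ↦ extChartAt 𝓘(ℝ, E) q
      ((extChartAt 𝓘(ℝ, E) p).symm (chartCurve E p γ s))) t := by
    refine h.comp (ψ := fun y ↦ extChartAt 𝓘(ℝ, E) q ((extChartAt 𝓘(ℝ, E) p).symm y))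
      (contDiffAt_chartCurve hγ hp) hψ
      ((isMetricOn_chartForm p).hasFDerivAt hx).differentiableAt
      ((isMetricOn_chartForm q).hasFDerivAt hψx).differentiableAt
      (chartForm_symm q _) ?_ ?_
    · filter_upwards [(isOpen_extChartAt_target p).mem_nhds hx,
        (contMDiffAt_extChartAt_symm hx).continuousAt
          ((isOpen_extChartAt_source (I := 𝓘(ℝ, E)) q).mem_nhds hq')] with y hy hyq v w
      rw [(hasFDerivAt_transition hy hyq).fderiv]
      exact (chartForm_chartDeriv hyq _ _).symm
    · rw [hd.fderiv]
      exact (chartDeriv_surjective hq').comp (chartSymmDeriv_surjective hx)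
  refine hcomp.congr ?_
  filter_upwards [hγ.continuousAt
    ((isOpen_extChartAt_source (I := 𝓘(ℝ, E)) p).mem_nhds hp)] with s hs
  simp only [chartCurve]
  rw [(extChartAt 𝓘(ℝ, E) p).left_inv hs]

/-- Two geodesics with the same position and velocity at some time agree near this time. -/
lemma IsGeodesicAt.eventuallyEq {γ σ : ℝ → M} {t : ℝ} {p : M}
    (hp : γ t ∈ (extChartAt 𝓘(ℝ, E) p).source) (hγ : ∀ᶠ s in 𝓝 t, IsGeodesicAt E γ s)
    (hσ : ∀ᶠ s in 𝓝 t, IsGeodesicAt E σ s) (h0 : γ t = σ t)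
    (h1 : deriv (chartCurve E p γ) t = deriv (chartCurve E p σ) t) : γ =ᶠ[𝓝 t] σ := by
  have hsource {c : ℝ → M} (hc : ∀ᶠ s in 𝓝 t, IsGeodesicAt E c s) (hct : c t = γ t) :
      ∀ᶠ s in 𝓝 t, c s ∈ (extChartAt 𝓘(ℝ, E) p).source :=
    hc.self_of_nhds.smooth.continuousAt
      ((isOpen_extChartAt_source (I := 𝓘(ℝ, E)) p).mem_nhds (by rwa [hct]))
  have key {c : ℝ → M} (hc : ∀ᶠ s in 𝓝 t, IsGeodesicAt E c s) (hct : c t = γ t) :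
      ∀ᶠ s in 𝓝 t, ContDiffAt ℝ ∞ (chartCurve E p c) s
        ∧ GeodesicEq (chartForm p) (chartCurve E p c) s := by
    filter_upwards [hc, hsource hc hct] with s hs hs'
    exact ⟨contDiffAt_chartCurve hs.smooth hs', hs.equation p hs'⟩
  have := (isMetricOn_chartForm p).geodesic_unique (chartCurve_mem_target hp) (key hγ rfl)
    (key hσ h0.symm) (by simp only [chartCurve, h0]) h1
  filter_upwards [this, hsource hγ rfl, hsource hσ h0.symm] with s hs h2 h3
  exact (extChartAt 𝓘(ℝ, E) p).injOn h2 h3 hs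

/-- Near a point, geodesics exist on a uniform time interval for all the initial velocities that
are bounded in the chart. -/
lemma exists_isGeodesicAt (q : M) {R : ℝ} (hR : 0 < R) :
    ∃ ε > 0, ∀ᶠ x in 𝓝 q, ∀ v : E, ‖v‖ ≤ R → ∃ γ : ℝ → M, γ 0 = x ∧
      deriv (chartCurve E q γ) 0 = v ∧ ∀ t ∈ Ioo (-ε) ε, IsGeodesicAt E γ t := by
  obtain ⟨r, hr, ε, hε, h⟩ := (isMetricOn_chartForm q).exists_geodesic
    (mem_extChartAt_target (I := 𝓘(ℝ, E)) q)
  -- a solution with a small velocity, run at a different speed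
  set k := r / R with hk
  have hk0 : 0 < k := by positivity
  refine ⟨ε / k⁻¹, by positivity, ?_⟩
  have h1 : ∀ᶠ x in 𝓝 q, extChartAt 𝓘(ℝ, E) q x ∈ Metric.closedBall (extChartAt 𝓘(ℝ, E) q q) r :=
    (continuousAt_extChartAt q) (Metric.closedBall_mem_nhds _ hr)
  filter_upwards [h1, extChartAt_source_mem_nhds (I := 𝓘(ℝ, E)) q] with x hx hxs v hv
  obtain ⟨u, hu0, hu1, hu⟩ := h (extChartAt 𝓘(ℝ, E) q x) (k • v) (mem_closedBall_iff_norm.1 hx) (by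
    rw [norm_smul, Real.norm_eq_abs, abs_of_pos hk0]
    calc k * ‖v‖ ≤ k * R := by gcongr
      _ = r := by rw [hk]; field_simp)
  set σ : ℝ → M := fun t ↦ (extChartAt 𝓘(ℝ, E) q).symm (u t) with hσ
  have hσs : ∀ t ∈ Ioo (-ε) ε, σ t ∈ (extChartAt 𝓘(ℝ, E) q).source := fun t ht ↦
    (extChartAt 𝓘(ℝ, E) q).map_target (hu t ht).1
  have hσu : ∀ t ∈ Ioo (-ε) ε, chartCurve E q σ t = u t := fun t ht ↦
    (extChartAt 𝓘(ℝ, E) q).right_inv (hu t ht).1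
  have hσu' : ∀ t ∈ Ioo (-ε) ε, u =ᶠ[𝓝 t] chartCurve E q σ := fun t ht ↦ by
    filter_upwards [Ioo_mem_nhds ht.1 ht.2] with s hs using (hσu s hs).symm
  have hσg : ∀ t ∈ Ioo (-ε) ε, IsGeodesicAt E σ t := fun t ht ↦
    .of_chart ((contMDiffAt_extChartAt_symm (hu t ht).1).comp t (hu t ht).2.1.contMDiffAt)
      (hσs t ht) ((hu t ht).2.2.congr (hσu' t ht))
  have h00 : (0 : ℝ) ∈ Ioo (-ε) ε := ⟨by linarith, hε⟩
  refine ⟨fun t ↦ σ (k⁻¹ * t + 0), ?_, ?_, fun t ht ↦ (hσg _ ?_).comp_affine⟩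
  · simp only [mul_zero, add_zero, hσ, hu0]
    exact (extChartAt 𝓘(ℝ, E) q).left_inv hxs
  · have : chartCurve E q (fun t ↦ σ (k⁻¹ * t + 0)) = fun t ↦ chartCurve E q σ (k⁻¹ * t + 0) := rfl
    rw [this, deriv_comp_affine, mul_zero, add_zero, ← (hσu' 0 h00).deriv_eq, hu1,
      inv_smul_smul₀ hk0.ne']
  · have hk1 : 0 < k⁻¹ := by positivity
    rw [add_zero]
    constructor
    · have := ht.1
      rw [← neg_div, div_lt_iff₀ hk1] at this
      linarith
    · have := ht.2
      rw [lt_div_iff₀ hk1] at this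
      linarith

lemma IsGeodesicAt.eventually_mdifferentiableAt {γ : ℝ → M} {t : ℝ} (h : IsGeodesicAt E γ t) :
    ∀ᶠ s in 𝓝 t, MDifferentiableAt 𝓘(ℝ, ℝ) 𝓘(ℝ, E) γ s :=
  ((contMDiffAt_iff_contMDiffAt_nhds (by simp)).1 (h.smooth.of_le (m := 1) (by simp))).mono
    fun _ hs ↦ hs.mdifferentiableAt one_ne_zero

/-- Geodesics have constant speed. -/
lemma norm_velocity_eq {γ : ℝ → M} {a b : ℝ} (hab : a ≤ b)
    (h : ∀ t ∈ Icc a b, IsGeodesicAt E γ t) :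
    ‖velocity (E := E) γ b‖ = ‖velocity (E := E) γ a‖ := by
  have hd : ∀ t ∈ Icc a b, HasDerivAt (fun t ↦ ‖velocity (E := E) γ t‖ ^ 2) 0 t := by
    intro t ht
    have hs := mem_extChartAt_source (I := 𝓘(ℝ, E)) (γ t)
    have h1 := (isMetricOn_chartForm (γ t)).hasDerivAt_energyDensity
      (contDiffAt_chartCurve (h t ht).smooth hs) (chartCurve_mem_target hs) ((h t ht).equation _ hs)
    refine h1.congr_of_eventuallyEq ?_
    filter_upwards [(h t ht).eventually_mdifferentiableAt, (h t ht).smooth.continuousAt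
      ((isOpen_extChartAt_source (I := 𝓘(ℝ, E)) (γ t)).mem_nhds hs)] with s h2 h3
    exact norm_velocity_sq h2 h3
  have := constant_of_has_deriv_right_zero
    (fun t ht ↦ (hd t ht).continuousAt.continuousWithinAt)
    (fun t ht ↦ (hd t ⟨ht.1, ht.2.le⟩).hasDerivWithinAt) b ⟨hab, le_rfl⟩
  exact (sq_eq_sq₀ (norm_nonneg _) (norm_nonneg _)).1 this

end Manifold

/-! ### Length and distance; divergent curves in complete manifolds -/

/-- The fundamental inequality for an everywhere differentiable curve; the derivative need not be
continuous. -/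
lemma enorm_sub_le_lintegral_deriv {F : Type*} [NormedAddCommGroup F] [NormedSpace ℝ F]
    [CompleteSpace F] {f : ℝ → F} {a b : ℝ} (hab : a ≤ b)
    (hf : ∀ t ∈ Icc a b, DifferentiableAt ℝ f t) :
    ‖f b - f a‖ₑ ≤ ∫⁻ t in Icc a b, ‖deriv f t‖ₑ := by
  by_cases hfin : ∫⁻ t in Icc a b, ‖deriv f t‖ₑ = ⊤
  · simp [hfin]
  have hint : MeasureTheory.IntegrableOn (deriv f) (Icc a b) :=
    ⟨(stronglyMeasurable_deriv f).aestronglyMeasurable, lt_top_iff_ne_top.2 hfin⟩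
  have hint' : IntervalIntegrable (deriv f) MeasureTheory.volume a b := by
    rwa [intervalIntegrable_iff_integrableOn_Icc_of_le hab]
  rw [← intervalIntegral.integral_eq_sub_of_hasDerivAt
    (fun t ht ↦ (hf t (by rwa [uIcc_of_le hab] at ht)).hasDerivAt) hint',
    intervalIntegral.integral_of_le hab]
  refine (MeasureTheory.enorm_integral_le_lintegral_enorm _).trans ?_
  exact MeasureTheory.lintegral_mono_set Ioc_subset_Icc_self

section LocalMetric

variable {E : Type*} [NormedAddCommGroup E] [NormedSpace ℝ E] [FiniteDimensional ℝ E]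
  {G : E → E →L[ℝ] E →L[ℝ] ℝ} {U : Set E}

/-- By continuity, the metric near `x₀` is as close as desired to the constant metric `G x₀`. -/
lemma IsMetricOn.exists_comparison (hG : IsMetricOn G U) {x₀ : E} (hx₀ : x₀ ∈ U) {k : ℝ}
    (hk : 1 < k) : ∃ ρ > 0, Metric.ball x₀ ρ ⊆ U ∧ ∀ x ∈ Metric.ball x₀ ρ, ∀ v,
      G x v v ≤ k * G x₀ v v ∧ G x₀ v v ≤ k * G x v v := by
  obtain ⟨c, hc, hcG⟩ := exists_pos_mul_sq_norm_le (G x₀) (hG.pos x₀ hx₀)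
  set δ := (k - 1) / k with hδ
  have hδ0 : 0 < δ := div_pos (by linarith) (by linarith)
  have hδk : k * δ = k - 1 := by rw [hδ]; field_simp
  have h3 : ∀ᶠ x in 𝓝 x₀, ‖G x - G x₀‖ < c * δ := by
    have := Metric.continuousAt_iff'.1 (hG.contDiffAt hx₀).continuousAt (c * δ) (by positivity)
    simpa only [dist_eq_norm] using this
  obtain ⟨ρ, hρ, hsub⟩ := Metric.nhds_basis_ball.mem_iff.1
    (Filter.inter_mem h3 (hG.isOpen.mem_nhds hx₀))
  refine ⟨ρ, hρ, fun x hx ↦ (hsub hx).2, fun x hx v ↦ ?_⟩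
  have h1 : ‖(G x - G x₀) v v‖ ≤ c * δ * ‖v‖ * ‖v‖ :=
    ((G x - G x₀).le_opNorm₂ v v).trans (by gcongr; exact (hsub hx).1.le)
  have h2 : c * δ * ‖v‖ * ‖v‖ ≤ δ * G x₀ v v := by nlinarith [hcG v]
  have h0 := hG.nonneg hx₀ v
  simp only [sub_apply, Real.norm_eq_abs] at h1
  obtain ⟨h4, h5⟩ := abs_le.1 h1
  have h6 : δ ≤ k - 1 := by nlinarith
  constructor
  · nlinarith
  · have : k * (G x₀ v v - G x v v) ≤ (k - 1) * G x₀ v v := by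
      calc k * (G x₀ v v - G x v v) ≤ k * (δ * G x₀ v v) := by gcongr; linarith
        _ = (k - 1) * G x₀ v v := by rw [← mul_assoc, hδk]
    linarith

end LocalMetric

section Manifold

variable {E : Type*} [NormedAddCommGroup E] [NormedSpace ℝ E] [FiniteDimensional ℝ E]
  {M : Type*} [EMetricSpace M] [ChartedSpace E M] [IsManifold 𝓘(ℝ, E) ∞ M]
  [RiemannianBundle (fun x : M ↦ TangentSpace 𝓘(ℝ, E) x)]
  [IsContMDiffRiemannianBundle 𝓘(ℝ, E) ∞ E (fun x : M ↦ TangentSpace 𝓘(ℝ, E) x)]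
  [IsRiemannianManifold 𝓘(ℝ, E) M]

lemma edist_le_pathELength_of_contMDiffOn {c : ℝ → M} {a b : ℝ} (hab : a ≤ b)
    (hc : ContMDiffOn 𝓘(ℝ, ℝ) 𝓘(ℝ, E) 1 c (Icc a b)) :
    edist (c a) (c b) ≤ pathELength 𝓘(ℝ, E) c a b := by
  rw [IsRiemannianManifold.out (I := 𝓘(ℝ, E)) (c a) (c b)]
  exact riemannianEDist_le_pathELength hc rfl rfl hab

/-- The distance between two points of a chart is bounded by the length of the segment joining
them in the chart. -/
lemma edist_symm_le_of_segment {p : M} {a b : E} {K : ℝ} (hK : 0 ≤ K)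
    (hseg : segment ℝ a b ⊆ (extChartAt 𝓘(ℝ, E) p).target)
    (hG : ∀ z ∈ segment ℝ a b, chartForm p z (b - a) (b - a) ≤ K ^ 2) :
    edist ((extChartAt 𝓘(ℝ, E) p).symm a) ((extChartAt 𝓘(ℝ, E) p).symm b) ≤ ENNReal.ofReal K := by
  set l : ℝ → E := ⇑(AffineMap.lineMap (k := ℝ) a b) with hl
  set γ : ℝ → M := fun t ↦ (extChartAt 𝓘(ℝ, E) p).symm (l t) with hγ
  have hlseg : ∀ t ∈ Icc (0 : ℝ) 1, l t ∈ segment ℝ a b := fun t ht ↦ by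
    rw [segment_eq_image_lineMap]
    exact ⟨t, ht, rfl⟩
  have hld (t : ℝ) : HasDerivAt l (b - a) t := AffineMap.hasDerivAt_lineMap
  have hls : ContDiff ℝ ∞ l := by
    have : l = fun t ↦ t • (b - a) + a := funext fun t ↦ AffineMap.lineMap_apply_module' a b t
    rw [this]
    fun_prop
  have hγs : ∀ t ∈ Icc (0 : ℝ) 1, ContMDiffAt 𝓘(ℝ, ℝ) 𝓘(ℝ, E) ∞ γ t := fun t ht ↦
    (contMDiffAt_extChartAt_symm (hseg (hlseg t ht))).comp t hls.contMDiff.contMDiffAt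
  have h0 : γ 0 = (extChartAt 𝓘(ℝ, E) p).symm a := by simp [hγ, hl]
  have h1 : γ 1 = (extChartAt 𝓘(ℝ, E) p).symm b := by simp [hγ, hl]
  rw [← h0, ← h1]
  refine (edist_le_pathELength_of_contMDiffOn (E := E) zero_le_one
    fun t ht ↦ ((hγs t ht).of_le (by simp)).contMDiffWithinAt).trans ?_
  rw [pathELength_eq_lintegral_velocity]
  calc ∫⁻ t in Icc (0 : ℝ) 1, ‖velocity (E := E) γ t‖ₑ
      ≤ ∫⁻ _ in Icc (0 : ℝ) 1, ENNReal.ofReal K := by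
        refine MeasureTheory.setLIntegral_mono' measurableSet_Icc fun t ht ↦ ?_
        have ht' := hseg (hlseg t ht)
        have hs : γ t ∈ (extChartAt 𝓘(ℝ, E) p).source := (extChartAt 𝓘(ℝ, E) p).map_target ht'
        have hev : chartCurve E p γ =ᶠ[𝓝 t] l := by
          filter_upwards [hls.continuous.continuousAt
            ((isOpen_extChartAt_target p).mem_nhds ht')] with s hs
          exact (extChartAt 𝓘(ℝ, E) p).right_inv hs
        rw [enorm_velocity ((hγs t ht).mdifferentiableAt (by simp)) hs, hev.deriv_eq,
          hev.self_of_nhds, (hld t).deriv]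
        apply ENNReal.ofReal_le_ofReal
        rw [Real.sqrt_le_left hK]
        exact hG _ (hlseg t ht)
    _ = ENNReal.ofReal K := by simp

/-- Locally, the distance between two points of a differentiable curve is bounded by twice the
length of the curve between these points. -/
lemma eventually_edist_le {c : ℝ → M} {t₀ : ℝ}
    (hc : ∀ᶠ t in 𝓝 t₀, MDifferentiableAt 𝓘(ℝ, ℝ) 𝓘(ℝ, E) c t) :
    ∃ δ > 0, ∀ a ∈ Ioo (t₀ - δ) (t₀ + δ), ∀ b ∈ Ioo (t₀ - δ) (t₀ + δ), a ≤ b →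
      edist (c a) (c b) ≤ 2 * pathELength 𝓘(ℝ, E) c a b := by
  set p := c t₀ with hp
  set x₀ := extChartAt 𝓘(ℝ, E) p p with hx₀
  obtain ⟨ρ, hρ, hsub, hcomp⟩ := (isMetricOn_chartForm p).exists_comparison
    (mem_extChartAt_target (I := 𝓘(ℝ, E)) p) one_lt_two
  have hcc : ContinuousAt c t₀ := hc.self_of_nhds.continuousAt
  have hsrc : ∀ᶠ t in 𝓝 t₀, c t ∈ (extChartAt 𝓘(ℝ, E) p).source :=
    hcc (extChartAt_source_mem_nhds (I := 𝓘(ℝ, E)) p)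
  have hball : ∀ᶠ t in 𝓝 t₀, chartCurve E p c t ∈ Metric.ball x₀ ρ :=
    ((continuousAt_extChartAt p).comp_of_eq hcc rfl) (Metric.ball_mem_nhds _ hρ)
  obtain ⟨δ, hδ, hδs⟩ := Metric.nhds_basis_ball.mem_iff.1
    (Filter.inter_mem hc (Filter.inter_mem hsrc hball))
  rw [Real.ball_eq_Ioo] at hδs
  refine ⟨δ, hδ, fun a ha b hb hab ↦ ?_⟩
  have hI : Icc a b ⊆ Ioo (t₀ - δ) (t₀ + δ) := Icc_subset_Ioo ha.1 hb.2
  set u := chartCurve E p c with hu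
  -- composing with the isometry `A` from `(E, G x₀)` turns lengths for the constant metric `G x₀`
  -- into lengths in a normed space
  set A := chartSymmDeriv (E := E) p x₀ with hA
  have hAn (v : E) : ‖A v‖ ^ 2 = chartForm p x₀ v v := (real_inner_self_eq_norm_sq _).symm
  have hud : ∀ t ∈ Icc a b, DifferentiableAt ℝ u t := fun t ht ↦
    (hasDerivAt_chartCurve (hδs (hI ht)).1 (hδs (hI ht)).2.1).differentiableAt
  have : CompleteSpace (TangentSpace 𝓘(ℝ, E) ((extChartAt 𝓘(ℝ, E) p).symm x₀)) := by
    have : FiniteDimensional ℝ (TangentSpace 𝓘(ℝ, E) ((extChartAt 𝓘(ℝ, E) p).symm x₀)) :=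
      inferInstanceAs (FiniteDimensional ℝ E)
    exact FiniteDimensional.complete ℝ _
  have h1 : ‖A (u b - u a)‖ₑ ≤ ∫⁻ t in Icc a b, ‖A (deriv u t)‖ₑ := by
    have := enorm_sub_le_lintegral_deriv (f := fun t ↦ A (u t)) hab
      (fun t ht ↦ (A.hasFDerivAt.comp_hasDerivAt t (hud t ht).hasDerivAt).differentiableAt)
    rw [map_sub]
    refine this.trans (MeasureTheory.setLIntegral_mono' measurableSet_Icc fun t ht ↦ ?_)
    exact le_of_eq (congrArg _ (A.hasFDerivAt.comp_hasDerivAt t (hud t ht).hasDerivAt).deriv)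
  have h2 : ∫⁻ t in Icc a b, ‖A (deriv u t)‖ₑ
      ≤ ENNReal.ofReal (√2) * pathELength 𝓘(ℝ, E) c a b := by
    rw [pathELength_eq_lintegral_velocity, ← MeasureTheory.lintegral_const_mul' _ _ (by simp)]
    refine MeasureTheory.setLIntegral_mono' measurableSet_Icc fun t ht ↦ ?_
    obtain ⟨h3, h4, h5⟩ := hδs (hI ht)
    rw [← ofReal_norm, ← ofReal_norm, ← ENNReal.ofReal_mul (by positivity)]
    apply ENNReal.ofReal_le_ofReal
    rw [← abs_of_nonneg (norm_nonneg (A _)), ← abs_of_nonneg (mul_nonneg (Real.sqrt_nonneg 2)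
      (norm_nonneg (velocity (E := E) c t))), ← sq_le_sq, mul_pow, hAn,
      Real.sq_sqrt (by norm_num), norm_velocity_sq h3 h4]
    exact (hcomp _ h5 _).2
  have h3 : edist (c a) (c b) ≤ ENNReal.ofReal (√2 * ‖A (u b - u a)‖) := by
    have hseg : segment ℝ (u a) (u b) ⊆ Metric.ball x₀ ρ :=
      (convex_ball x₀ ρ).segment_subset (hδs ha).2.2 (hδs hb).2.2
    have := edist_symm_le_of_segment (p := p) (a := u a) (b := u b)
      (K := √2 * ‖A (u b - u a)‖) (by positivity) (hseg.trans hsub) (fun z hz ↦ by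
        rw [mul_pow, Real.sq_sqrt (by norm_num), hAn]
        exact (hcomp z (hseg hz) _).1)
    rwa [hu, chartCurve, chartCurve, (extChartAt 𝓘(ℝ, E) p).left_inv (hδs ha).2.1,
      (extChartAt 𝓘(ℝ, E) p).left_inv (hδs hb).2.1] at this
  calc edist (c a) (c b) ≤ ENNReal.ofReal (√2) * ‖A (u b - u a)‖ₑ := by
        rwa [← ofReal_norm, ← ENNReal.ofReal_mul (by positivity)]
    _ ≤ ENNReal.ofReal (√2) * (ENNReal.ofReal (√2) * pathELength 𝓘(ℝ, E) c a b) := by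
        gcongr
        exact h1.trans h2
    _ = 2 * pathELength 𝓘(ℝ, E) c a b := by
        rw [← mul_assoc, ← ENNReal.ofReal_mul (by positivity), Real.mul_self_sqrt (by norm_num)]
        simp

/-- The distance between two points of a differentiable curve is bounded by twice the length of
the curve. (The constant could be `1`; any constant does for Cauchy sequences.) -/
lemma edist_le_two_mul_pathELength {c : ℝ → M} {a b α β : ℝ} (ha : α < a) (hb : b < β) (hab : a ≤ b)
    (hc : ∀ t ∈ Ioo α β, MDifferentiableAt 𝓘(ℝ, ℝ) 𝓘(ℝ, E) c t) :
    edist (c a) (c b) ≤ 2 * pathELength 𝓘(ℝ, E) c a b := by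
  have hloc : ∀ t : Icc a b, ∃ δ > 0, ∀ x ∈ Ioo (t.1 - δ) (t.1 + δ),
      ∀ y ∈ Ioo (t.1 - δ) (t.1 + δ), x ≤ y →
      edist (c x) (c y) ≤ 2 * pathELength 𝓘(ℝ, E) c x y := fun t ↦ by
    apply eventually_edist_le
    filter_upwards [Ioo_mem_nhds (ha.trans_le t.2.1) (t.2.2.trans_lt hb)] with s hs using hc s hs
  choose δ hδ hδc using hloc
  obtain ⟨t, ht0, htm, ⟨m, hm⟩, hti⟩ := exists_monotone_Icc_subset_open_cover_Icc hab
    (c := fun t : Icc a b ↦ Subtype.val ⁻¹' Ioo (t.1 - δ t) (t.1 + δ t))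
    (fun t ↦ isOpen_Ioo.preimage continuous_subtype_val)
    (fun t _ ↦ mem_iUnion.2 ⟨t, by constructor <;> linarith [hδ t]⟩)
  have key (n : ℕ) : edist (c a) (c (t n)) ≤ 2 * pathELength 𝓘(ℝ, E) c a (t n) := by
    induction n with
    | zero => simp [ht0]
    | succ n ih =>
      obtain ⟨i, hi⟩ := hti n
      have hle : t n ≤ t (n + 1) := htm n.le_succ
      have h1 := hδc i (t n) (hi ⟨le_rfl, hle⟩) (t (n + 1)) (hi ⟨hle, le_rfl⟩) hle
      calc edist (c a) (c (t (n + 1))) ≤ edist (c a) (c (t n)) + edist (c (t n)) (c (t (n + 1))) :=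
            edist_triangle _ _ _
        _ ≤ 2 * pathELength 𝓘(ℝ, E) c a (t n) + 2 * pathELength 𝓘(ℝ, E) c (t n) (t (n + 1)) :=
            add_le_add ih h1
        _ = 2 * pathELength 𝓘(ℝ, E) c a (t (n + 1)) := by
            rw [← mul_add, pathELength_add (t n).2.1 hle]
  have := key m
  rwa [hm m le_rfl] at this

/-- In a complete Riemannian manifold, divergent curves have infinite length. -/
theorem curveLength_eq_top_of_completeSpace [CompleteSpace M] {T : EReal} {c : ℝ → M}
    (hc : IsDivergentCurve E T c) : curveLength E T c = ⊤ := by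
  by_contra hfin
  set L := curveLength E T c with hL
  have hle : ∀ t ∈ zeroIco T, pathELength 𝓘(ℝ, E) c 0 t ≤ L := fun t ht ↦ le_iSup₂_of_le t ht le_rfl
  have h0 : (0 : ℝ) ∈ zeroIco T := ⟨le_rfl, by exact_mod_cast hc.pos⟩
  -- positive times only: at `0` the curve is differentiable from the right, and its values at
  -- negative times are arbitrary
  have hdist : ∀ s t : ℝ, 0 < s → s ≤ t → t ∈ zeroIco T →
      edist (c s) (c t) ≤ 2 * pathELength 𝓘(ℝ, E) c s t := by
    intro s t hs hst ht
    obtain ⟨β, hβ1, hβ2⟩ := EReal.lt_iff_exists_real_btwn.1 ht.2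
    refine edist_le_two_mul_pathELength (α := 0) (β := β) hs (by exact_mod_cast hβ1) hst
      fun r hr ↦ ?_
    have hrT : Ioo 0 β ⊆ zeroIco T := fun x hx ↦
      ⟨hx.1.le, (EReal.coe_lt_coe_iff.2 hx.2).trans hβ2⟩
    exact (hc.differentiable r (hrT hr)).mdifferentiableAt
      (Filter.mem_of_superset (Ioo_mem_nhds hr.1 hr.2) hrT)
  have : Nonempty (zeroIco T) := ⟨⟨0, h0⟩⟩
  have hcauchy : CauchySeq (fun t : zeroIco T ↦ c t) := by
    rw [EMetric.cauchySeq_iff']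
    intro ε hε
    -- after some time `N`, the remaining length is at most `ε / 4`
    have hη0 : ε / 4 ≠ 0 := (ENNReal.div_pos hε.ne' (by simp)).ne'
    obtain ⟨N, hN, hLN⟩ : ∃ N ∈ zeroIco T, L < pathELength 𝓘(ℝ, E) c 0 N + min (ε / 4) 1 := by
      by_contra! hcon
      have h1 : L + min (ε / 4) 1 ≤ L := by
        conv_lhs => rw [hL, curveLength, ENNReal.biSup_add' ⟨0, h0⟩]
        exact iSup₂_le hcon
      exact absurd h1 (not_le.2 (ENNReal.lt_add_right hfin (by simp [hη0])))
    obtain ⟨N', hN'1, hN'2⟩ := EReal.lt_iff_exists_real_btwn.1 hN.2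
    have hNN : N < N' := EReal.coe_lt_coe_iff.1 hN'1
    have hN' : N' ∈ zeroIco T := ⟨hN.1.trans hNN.le, hN'2⟩
    refine ⟨⟨N', hN'⟩, fun t ht ↦ ?_⟩
    have ht' : N' ≤ t := ht
    rw [edist_comm]
    have h3 : pathELength 𝓘(ℝ, E) c N t ≤ min (ε / 4) 1 := by
      have h4 := hle t t.2
      rw [← pathELength_add hN.1 (hNN.le.trans ht')] at h4
      have h5 : pathELength 𝓘(ℝ, E) c 0 N ≠ ⊤ := ne_top_of_le_ne_top hfin (hle N hN)
      exact (ENNReal.add_le_add_iff_left h5).1 (h4.trans hLN.le)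
    have h4 : pathELength 𝓘(ℝ, E) c N' t ≤ pathELength 𝓘(ℝ, E) c N t := by
      rw [← pathELength_add hNN.le ht']
      exact le_add_self
    have h6 : min (ε / 4) 1 < ε / 2 := by
      rcases eq_or_ne ε ⊤ with rfl | h
      · simp [ENNReal.top_div]
      · refine (min_le_left _ _).trans_lt ?_
        have : ε / 4 = ε / 2 / 2 := by
          rw [div_eq_mul_inv, div_eq_mul_inv, div_eq_mul_inv, mul_assoc,
            ← ENNReal.mul_inv (by simp) (by simp)]
          norm_num
        rw [this]
        exact ENNReal.half_lt_self (ENNReal.div_pos hε.ne' (by simp)).ne'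
          (ENNReal.div_ne_top h (by simp))
    calc edist (c N') (c t) ≤ 2 * pathELength 𝓘(ℝ, E) c N' t :=
          hdist N' t (hN.1.trans_lt hNN) ht' t.2
      _ ≤ 2 * min (ε / 4) 1 := by gcongr; exact h4.trans h3
      _ < 2 * (ε / 2) := by
          rw [ENNReal.mul_lt_mul_iff_right (by simp) (by simp)]
          exact h6
      _ = ε := ENNReal.mul_div_cancel (by simp) (by simp)
  -- the curve converges, so it stays in a compact neighborhood of its limit
  obtain ⟨x, hx⟩ := cauchySeq_tendsto_of_complete hcauchy
  have : LocallyCompactSpace M := Manifold.locallyCompact_of_finiteDimensional 𝓘(ℝ, E)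
  obtain ⟨K, hK, hxK⟩ := exists_compact_mem_nhds x
  obtain ⟨t₀, ht₀, ht₀T, hesc⟩ := hc.escapes K hK
  obtain ⟨N, hN⟩ := Filter.eventually_atTop.1 (hx hxK)
  obtain ⟨t, ht1, ht2⟩ := EReal.lt_iff_exists_real_btwn.1 (max_lt N.2.2 ht₀T)
  have ht3 : (N : ℝ) < t := EReal.coe_lt_coe_iff.1 ((le_max_left _ _).trans_lt ht1)
  have ht4 : t₀ < t := EReal.coe_lt_coe_iff.1 ((le_max_right _ _).trans_lt ht1)
  exact hesc t ht4 ht2 (hN ⟨t, (ht₀.trans ht4).le, ht2⟩ ht3.le)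

end Manifold

/-! ### Extension of geodesics -/

section Extension

variable {E : Type*} [NormedAddCommGroup E] [NormedSpace ℝ E] [FiniteDimensional ℝ E]
  {M : Type*} [EMetricSpace M] [ChartedSpace E M] [IsManifold 𝓘(ℝ, E) ∞ M]
  [RiemannianBundle (fun x : M ↦ TangentSpace 𝓘(ℝ, E) x)]
  [IsContMDiffRiemannianBundle 𝓘(ℝ, E) ∞ E (fun x : M ↦ TangentSpace 𝓘(ℝ, E) x)]

/-- Two geodesics on an interval that agree near one time agree on the interval. -/
lemma IsGeodesicAt.eqOn {γ σ : ℝ → M} {s : Set ℝ} (hso : IsOpen s) (hs : IsPreconnected s)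
    (hγ : ∀ t ∈ s, IsGeodesicAt E γ t) (hσ : ∀ t ∈ s, IsGeodesicAt E σ t) {t₀ : ℝ} (ht₀ : t₀ ∈ s)
    (h : γ =ᶠ[𝓝 t₀] σ) : EqOn γ σ s := by
  have hsub : s ⊆ {t | γ =ᶠ[𝓝 t] σ} := by
    refine hs.subset_of_closure_inter_subset isOpen_setOfPred_eventually_nhds ⟨t₀, ht₀, h⟩ ?_
    rintro t ⟨htc, hts⟩
    have hfreq : ∃ᶠ y in 𝓝 t, γ =ᶠ[𝓝 y] σ := mem_closure_iff_frequently.1 htc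
    have h0 : γ t = σ t := tendsto_nhds_unique_of_frequently_eq (hγ t hts).smooth.continuousAt
      (hσ t hts).smooth.continuousAt (hfreq.mono fun y hy ↦ hy.self_of_nhds)
    have hp := mem_extChartAt_source (I := 𝓘(ℝ, E)) (γ t)
    refine IsGeodesicAt.eventuallyEq hp (Filter.mem_of_superset (hso.mem_nhds hts) hγ)
      (Filter.mem_of_superset (hso.mem_nhds hts) hσ) h0 ?_
    refine tendsto_nhds_unique_of_frequently_eq
      (contDiffAt_chartCurve (hγ t hts).smooth hp).deriv_infty.continuousAt
      (contDiffAt_chartCurve (hσ t hts).smooth (by rwa [← h0])).deriv_infty.continuousAt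
      (hfreq.mono fun y hy ↦ Filter.EventuallyEq.deriv_eq ?_)
    exact hy.mono fun z hz ↦ by simp only [chartCurve, hz]
  exact fun t ht ↦ (hsub ht).self_of_nhds

lemma pathELength_eq_mul {γ : ℝ → M} {a b : ℝ} (h : ∀ t ∈ Icc a b, IsGeodesicAt E γ t) :
    pathELength 𝓘(ℝ, E) γ a b = ‖velocity (E := E) γ a‖ₑ * ENNReal.ofReal (b - a) := by
  rw [pathELength_eq_lintegral_velocity]
  calc ∫⁻ s in Icc a b, ‖velocity (E := E) γ s‖ₑ
      = ∫⁻ _ in Icc a b, ‖velocity (E := E) γ a‖ₑ := by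
        refine MeasureTheory.setLIntegral_congr_fun measurableSet_Icc fun s hs ↦ ?_
        rw [← ofReal_norm, norm_velocity_eq hs.1 (fun r hr ↦ h r ⟨hr.1, hr.2.trans hs.2⟩),
          ofReal_norm]
    _ = ‖velocity (E := E) γ a‖ₑ * ENNReal.ofReal (b - a) := by simp

/-- Near a point, a bound on the speed of a curve gives a bound on its velocity in the chart. -/
lemma exists_norm_deriv_chartCurve_le (q : M) (S : ℝ) : ∃ R > 0, ∀ᶠ y in 𝓝 q,
    ∀ (c : ℝ → M) (t : ℝ), c t = y → MDifferentiableAt 𝓘(ℝ, ℝ) 𝓘(ℝ, E) c t →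
      ‖velocity (E := E) c t‖ ≤ S → ‖deriv (chartCurve E q c) t‖ ≤ R := by
  have hx₀ := mem_extChartAt_target (I := 𝓘(ℝ, E)) q
  obtain ⟨m, hm, hmG⟩ := exists_pos_mul_sq_norm_le (chartForm q (extChartAt 𝓘(ℝ, E) q q))
    ((isMetricOn_chartForm q).pos _ hx₀)
  obtain ⟨ρ, hρ, -, hcomp⟩ := (isMetricOn_chartForm q).exists_comparison hx₀ one_lt_two
  refine ⟨√(2 / m * S ^ 2) + 1, by positivity, ?_⟩
  filter_upwards [extChartAt_source_mem_nhds (I := 𝓘(ℝ, E)) q,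
    (continuousAt_extChartAt (I := 𝓘(ℝ, E)) q) (Metric.ball_mem_nhds _ hρ)] with y hys hyρ c t hct
    hc hS
  have h1 := norm_velocity_sq (p := q) hc (by rwa [hct])
  have h2 : ‖velocity (E := E) c t‖ ^ 2 ≤ S ^ 2 := by gcongr
  have h3 := (hcomp (chartCurve E q c t) (by rw [chartCurve, hct]; exact hyρ)
    (deriv (chartCurve E q c) t)).2
  have h4 := hmG (deriv (chartCurve E q c) t)
  refine (Real.le_sqrt_of_sq_le ?_).trans (le_add_of_nonneg_right zero_le_one)
  rw [div_mul_eq_mul_div, le_div_iff₀ hm]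
  nlinarith

/-- If smooth divergent curves have infinite length, a geodesic on a bounded interval extends beyond
the right end of the interval. -/
lemma exists_isGeodesicAt_extension {γ : ℝ → M} {a b : ℝ} (hab : a < b)
    (hγ : ∀ t ∈ Ioo a b, IsGeodesicAt E γ t)
    (H : ∀ (T : EReal) (c : ℝ → M), IsDivergentCurve E T c →
      ContMDiffOn 𝓘(ℝ, ℝ) 𝓘(ℝ, E) ∞ c (zeroIco T) → curveLength E T c = ⊤) :
    ∃ b' > b, ∃ σ : ℝ → M, EqOn γ σ (Ioo a b) ∧ ∀ t ∈ Ioo a b', IsGeodesicAt E σ t := by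
  set t₀ := (a + b) / 2 with ht₀
  have hat : a < t₀ := by linarith
  have htb : t₀ < b := by linarith
  set S := ‖velocity (E := E) γ t₀‖ with hS
  -- `γ` from time `t₀` on has finite length, so it is not divergent
  obtain ⟨K, hK, hfreq⟩ : ∃ K : Set M, IsCompact K ∧ ∃ᶠ t in 𝓝[<] b, γ t ∈ K := by
    set c : ℝ → M := fun t ↦ γ (1 * t + t₀) with hc
    have hcg : ∀ t ∈ zeroIco ((b - t₀ : ℝ) : EReal), IsGeodesicAt E c t := fun t ht ↦ by
      have h1 := ht.1
      have h2 : t < b - t₀ := EReal.coe_lt_coe_iff.1 ht.2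
      exact (hγ (1 * t + t₀) ⟨by linarith, by linarith⟩).comp_affine
    have hcs : ContMDiffOn 𝓘(ℝ, ℝ) 𝓘(ℝ, E) ∞ c (zeroIco ((b - t₀ : ℝ) : EReal)) := fun t ht ↦
      (hcg t ht).smooth.contMDiffWithinAt
    have hlen : curveLength E ((b - t₀ : ℝ) : EReal) c ≠ ⊤ := by
      refine ne_top_of_le_ne_top (b := ‖velocity (E := E) c 0‖ₑ * ENNReal.ofReal (b - t₀))
        (ENNReal.mul_ne_top (by simp) (by simp)) (iSup₂_le fun t ht ↦ ?_)
      have h2 : t < b - t₀ := EReal.coe_lt_coe_iff.1 ht.2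
      rw [pathELength_eq_mul fun s hs ↦ hcg s ⟨hs.1, EReal.coe_lt_coe_iff.2 (hs.2.trans_lt h2)⟩,
        sub_zero]
      gcongr
    by_contra! hcon
    refine hlen (H _ c ⟨?_, hcs.mdifferentiableOn (by simp), fun K hK ↦ ?_⟩ hcs)
    · exact EReal.coe_lt_coe_iff.2 (by linarith : (0 : ℝ) < b - t₀)
    · obtain ⟨l, hl, hlK⟩ := (mem_nhdsLT_iff_exists_Ioo_subset' htb).1
        (hcon K hK)
      refine ⟨max (l - t₀) ((b - t₀) / 2), lt_max_of_lt_right (by linarith),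
        EReal.coe_lt_coe_iff.2 (max_lt (by linarith [show l < b from hl]) (by linarith)), fun t ht htT ↦ ?_⟩
      have h2 : t < b - t₀ := EReal.coe_lt_coe_iff.1 htT
      have h3 : l - t₀ < t := (le_max_left _ _).trans_lt ht
      exact hlK (show 1 * t + t₀ ∈ Ioo l b from ⟨by linarith, by linarith⟩)
  obtain ⟨q, -, hq⟩ := hK.exists_mapClusterPt_of_frequently hfreq
  -- restart from a point close to the limit point `q`
  obtain ⟨R, hR, hRb⟩ := exists_norm_deriv_chartCurve_le (E := E) q S
  obtain ⟨ε, hε, hex⟩ := exists_isGeodesicAt (E := E) q hR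
  have hnear := mapClusterPt_iff_frequently.1 hq _ (Filter.inter_mem hRb (Filter.inter_mem hex
    (extChartAt_source_mem_nhds (I := 𝓘(ℝ, E)) q)))
  obtain ⟨t₁, ⟨h1, h2, h3⟩, ht₁, ht₁b⟩ := (hnear.and_eventually
    (Ioo_mem_nhdsLT (max_lt htb (sub_lt_self b (half_pos hε))))).exists
  have ht₁t : t₀ < t₁ := (le_max_left _ _).trans_lt ht₁
  have ht₁ε : b - ε / 2 < t₁ := (le_max_right _ _).trans_lt ht₁
  have hg₁ := hγ t₁ ⟨hat.trans ht₁t, ht₁b⟩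
  have hv := h1 γ t₁ rfl hg₁.eventually_mdifferentiableAt.self_of_nhds
    (norm_velocity_eq ht₁t.le fun t ht ↦ hγ t ⟨hat.trans_le ht.1, ht.2.trans_lt ht₁b⟩).le
  obtain ⟨β, hβ0, hβ1, hβg⟩ := h2 _ hv
  set τ : ℝ → M := fun t ↦ β (1 * t + -t₁) with hτ
  have hτg : ∀ t ∈ Ioo (t₁ - ε) (t₁ + ε), IsGeodesicAt E τ t := fun t ht ↦
    (hβg _ ⟨by linarith [ht.1], by linarith [ht.2]⟩).comp_affine
  have hτ1 : deriv (chartCurve E q τ) t₁ = deriv (chartCurve E q γ) t₁ := by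
    have : chartCurve E q τ = fun t ↦ chartCurve E q β (1 * t + -t₁) := rfl
    rw [this, deriv_comp_affine, one_mul, one_smul, add_neg_cancel, hβ1]
  have heq : γ =ᶠ[𝓝 t₁] τ := IsGeodesicAt.eventuallyEq h3
    (Filter.mem_of_superset (Ioo_mem_nhds (hat.trans ht₁t) ht₁b) hγ)
    (Filter.mem_of_superset (Ioo_mem_nhds (by linarith) (by linarith)) hτg)
    (by simp [hτ, hβ0]) hτ1.symm
  have heqOn : EqOn γ τ (Ioo (max a (t₁ - ε)) b) :=
    IsGeodesicAt.eqOn isOpen_Ioo isPreconnected_Ioo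
      (fun t ht ↦ hγ t ⟨(le_max_left _ _).trans_lt ht.1, ht.2⟩)
      (fun t ht ↦ hτg t ⟨(le_max_right _ _).trans_lt ht.1, by linarith [ht.2]⟩)
      ⟨max_lt (hat.trans ht₁t) (by linarith), ht₁b⟩ heq
  refine ⟨t₁ + ε, by linarith, fun t ↦ if t < b then γ t else τ t,
    fun t ht ↦ by simp [ht.2], fun t ht ↦ ?_⟩
  rcases lt_or_ge t b with htb' | htb'
  · refine (hγ t ⟨ht.1, htb'⟩).congr ?_
    filter_upwards [Iio_mem_nhds htb'] with s hs
    exact (if_pos hs).symm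
  · refine (hτg t ⟨by linarith, ht.2⟩).congr ?_
    filter_upwards [Ioi_mem_nhds (max_lt ht.1 (by linarith : t₁ - ε < t))] with s hs
    split_ifs with hsb
    · exact (heqOn ⟨hs, hsb⟩).symm
    · rfl

/-- Geodesics with the same initial condition on symmetric intervals fit together. -/
lemma exists_isGeodesicAt_glue {x : M} {v : E} {A : Set ℝ} {T₀ : ℝ} (hT₀ : T₀ ∈ A) (hT₀' : 0 < T₀)
    (h : ∀ T ∈ A, ∃ γ : ℝ → M, γ 0 = x ∧ deriv (chartCurve E x γ) 0 = v ∧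
      ∀ t ∈ Ioo (-T) T, IsGeodesicAt E γ t) :
    ∃ γ : ℝ → M, γ 0 = x ∧ deriv (chartCurve E x γ) 0 = v ∧
      ∀ t, (∃ T ∈ A, |t| < T) → IsGeodesicAt E γ t := by
  classical
  have : Nonempty M := ⟨x⟩
  choose! g hg0 hg1 hg using h
  set σ : ℝ → M := fun t ↦ if ht : ∃ T ∈ A, |t| < T then g ht.choose t else x with hσ
  have key : ∀ T ∈ A, ∀ t ∈ Ioo (-T) T, g T =ᶠ[𝓝 t] σ := by
    intro T hT t ht
    filter_upwards [Ioo_mem_nhds ht.1 ht.2] with s hs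
    have hs' : ∃ T ∈ A, |s| < T := ⟨T, hT, abs_lt.2 hs⟩
    obtain ⟨h1, h2⟩ := hs'.choose_spec
    rw [hσ]
    simp only [dif_pos hs']
    set T' := hs'.choose
    have hm : |s| < min T T' := lt_min (abs_lt.2 hs) h2
    have hm0 : 0 < min T T' := (abs_nonneg s).trans_lt hm
    have hsub : Ioo (-min T T') (min T T') ⊆ Ioo (-T) T ∩ Ioo (-T') T' := fun r hr ↦ by
      rw [mem_Ioo, ← abs_lt] at hr
      exact ⟨abs_lt.1 (hr.trans_le (min_le_left _ _)), abs_lt.1 (hr.trans_le (min_le_right _ _))⟩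
    have hn : Ioo (-min T T') (min T T') ∈ 𝓝 0 := Ioo_mem_nhds (by linarith) hm0
    refine IsGeodesicAt.eqOn isOpen_Ioo isPreconnected_Ioo (fun r hr ↦ hg T hT r (hsub hr).1)
      (fun r hr ↦ hg T' h1 r (hsub hr).2) (t₀ := 0) ⟨by linarith, hm0⟩ ?_ (abs_lt.1 hm)
    refine IsGeodesicAt.eventuallyEq (p := x)
      (by rw [hg0 T hT]; exact mem_extChartAt_source x)
      (Filter.mem_of_superset hn fun r hr ↦ hg T hT r (hsub hr).1)
      (Filter.mem_of_superset hn fun r hr ↦ hg T' h1 r (hsub hr).2) ?_ ?_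
    · rw [hg0 T hT, hg0 T' h1]
    · rw [hg1 T hT, hg1 T' h1]
  have key0 := key T₀ hT₀ 0 ⟨by linarith, hT₀'⟩
  refine ⟨σ, by rw [← key0.self_of_nhds, hg0 T₀ hT₀], ?_, ?_⟩
  · rw [← hg1 T₀ hT₀]
    refine (Filter.EventuallyEq.deriv_eq ?_).symm
    exact key0.mono fun z hz ↦ by simp only [chartCurve, hz]
  · rintro t ⟨T, hT, htT⟩
    exact (hg T hT t (abs_lt.1 htT)).congr (key T hT t (abs_lt.1 htT))

lemma mk_velocity_eq {c : ℝ → M} {t : ℝ} {p y : M} (hct : c t = y)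
    (hc : MDifferentiableAt 𝓘(ℝ, ℝ) 𝓘(ℝ, E) c t) (hy : y ∈ (extChartAt 𝓘(ℝ, E) p).source)
    {w : TangentSpace 𝓘(ℝ, E) y} (h : deriv (chartCurve E p c) t = chartDeriv p y w) :
    (⟨c t, mfderiv 𝓘(ℝ, ℝ) 𝓘(ℝ, E) c t (1 : ℝ)⟩ : TangentBundle 𝓘(ℝ, E) M) = ⟨y, w⟩ := by
  subst hct
  have h1 : velocity (E := E) c t = w :=
    chartDeriv_injective hy ((chartDeriv_velocity hc hy).trans h)
  rw [← h1]
  rfl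

/-- If smooth divergent curves have infinite length, geodesics extend to all times: a maximal
geodesic defined up to a finite time would be a divergent curve of finite length. -/
theorem isGeodesicallyComplete_of_curveLength_eq_top
    (H : ∀ (T : EReal) (c : ℝ → M), IsDivergentCurve E T c →
      ContMDiffOn 𝓘(ℝ, ℝ) 𝓘(ℝ, E) ∞ c (zeroIco T) → curveLength E T c = ⊤) :
    IsGeodesicallyComplete E M := by
  rintro ⟨x, w⟩
  set v : E := chartDeriv x x w with hv
  set A : Set ℝ := {T | 0 < T ∧ ∃ γ : ℝ → M, γ 0 = x ∧ deriv (chartCurve E x γ) 0 = v ∧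
      ∀ t ∈ Ioo (-T) T, IsGeodesicAt E γ t} with hA
  obtain ⟨T₀, hT₀, h₀⟩ := exists_isGeodesicAt (E := E) x (R := ‖v‖ + 1) (by positivity)
  have hT₀A : T₀ ∈ A := ⟨hT₀, h₀.self_of_nhds v (by linarith)⟩
  have hall : ∀ T > 0, T ∈ A := by
    by_contra! hcon
    obtain ⟨T, hT, hTA⟩ := hcon
    have hub : T ∈ upperBounds A := by
      intro T' hT'
      by_contra! hlt
      obtain ⟨-, γ, h0, h1, h2⟩ := hT'
      exact hTA ⟨hT, γ, h0, h1, fun t ht ↦ h2 t ⟨by linarith [ht.1], by linarith [ht.2]⟩⟩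
    have hlub := isLUB_csSup ⟨T₀, hT₀A⟩ ⟨T, hub⟩
    set m := sSup A with hm
    have hm0 : 0 < m := hT₀.trans_le (hlub.1 hT₀A)
    obtain ⟨γ, h0, h1, h2⟩ := exists_isGeodesicAt_glue hT₀A hT₀ fun T hT ↦ hT.2
    have hγ : ∀ t ∈ Ioo (-m) m, IsGeodesicAt E γ t := fun t ht ↦ h2 t (by
      obtain ⟨T, hT, h⟩ := exists_lt_of_lt_csSup ⟨T₀, hT₀A⟩ (abs_lt.2 ht)
      exact ⟨T, hT, h⟩)
    obtain ⟨b, hb, σ, hσ, hσg⟩ := exists_isGeodesicAt_extension (by linarith) hγ H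
    -- the extension to the left is an extension to the right of the reversed geodesic
    obtain ⟨a, ha, τ, hτ, hτg⟩ := exists_isGeodesicAt_extension (a := -b) (b := m)
      (γ := fun t ↦ σ (-1 * t + 0)) (by linarith)
      (fun t ht ↦ (hσg (-1 * t + 0) ⟨by linarith [ht.2], by linarith [ht.1]⟩).comp_affine) H
    set θ : ℝ → M := fun t ↦ τ (-1 * t + 0) with hθ
    have hγθ : γ =ᶠ[𝓝 0] θ := by
      filter_upwards [Ioo_mem_nhds (neg_lt_zero.2 hm0) hm0] with t ht
      have := hτ (x := -1 * t + 0) ⟨by linarith [ht.2], by linarith [ht.1]⟩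
      rw [hθ, hσ ht]
      simp only [← this]
      ring_nf
    have hmem : min b a ∈ A := by
      refine ⟨lt_min (by linarith) (by linarith), θ, by rw [← hγθ.self_of_nhds, h0], ?_,
        fun t ht ↦ ?_⟩
      · rw [← h1]
        refine (Filter.EventuallyEq.deriv_eq ?_).symm
        exact hγθ.mono fun z hz ↦ by simp only [chartCurve, hz]
      · have h3 := min_le_left b a
        have h4 := min_le_right b a
        exact (hτg (-1 * t + 0) ⟨by linarith [ht.2], by linarith [ht.1]⟩).comp_affine
    exact absurd (hlub.1 hmem) (not_le.2 (lt_min hb ha))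
  obtain ⟨γ, h0, h1, h2⟩ := exists_isGeodesicAt_glue (hall 1 one_pos) one_pos fun T hT ↦ hT.2
  have hγ : ∀ t, IsGeodesicAt E γ t := fun t ↦
    h2 t ⟨|t| + 1, hall _ (by positivity), by linarith⟩
  exact ⟨γ, isGeodesic_iff.2 hγ, mk_velocity_eq h0
    (hγ 0).eventually_mdifferentiableAt.self_of_nhds (mem_extChartAt_source x) h1⟩

end Extension

/-! ### Short geodesics are minimizing -/

section Minimality

variable {E : Type*} [NormedAddCommGroup E] [NormedSpace ℝ E] [FiniteDimensional ℝ E]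
  {M : Type*} [EMetricSpace M] [ChartedSpace E M] [IsManifold 𝓘(ℝ, E) ∞ M]
  [RiemannianBundle (fun x : M ↦ TangentSpace 𝓘(ℝ, E) x)]
  [IsContMDiffRiemannianBundle 𝓘(ℝ, E) ∞ E (fun x : M ↦ TangentSpace 𝓘(ℝ, E) x)]

lemma IsGeodesicallyComplete.exists_isGeodesicAt (H : IsGeodesicallyComplete E M) (x : M) (v : E) :
    ∃ γ : ℝ → M, (∀ t, IsGeodesicAt E γ t) ∧ γ 0 = x ∧ deriv (chartCurve E x γ) 0 = v := by
  obtain ⟨w, rfl⟩ := chartDeriv_surjective (mem_extChartAt_source (I := 𝓘(ℝ, E)) x) v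
  obtain ⟨γ, hγ, h⟩ := H ⟨x, w⟩
  have hγ' := isGeodesic_iff.1 hγ
  have h0 : γ 0 = x := congrArg (fun w : TangentBundle 𝓘(ℝ, E) M ↦ w.1) h
  refine ⟨γ, hγ', h0, ?_⟩
  have h1 := congrArg (fun w : TangentBundle 𝓘(ℝ, E) M ↦ chartDeriv x w.1 w.2) h
  rw [← chartDeriv_velocity (hγ' 0).eventually_mdifferentiableAt.self_of_nhds
    (by rw [h0]; exact mem_extChartAt_source x)]
  exact h1

lemma eventually_mem_chart (x : M) {ρ : ℝ} (hρ : 0 < ρ) :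
    ∀ᶠ y in 𝓝 x, y ∈ (extChartAt 𝓘(ℝ, E) x).source ∧
      extChartAt 𝓘(ℝ, E) x y ∈ Metric.closedBall (extChartAt 𝓘(ℝ, E) x x) ρ :=
  Filter.inter_mem (extChartAt_source_mem_nhds (I := 𝓘(ℝ, E)) x)
    ((continuousAt_extChartAt (I := 𝓘(ℝ, E)) x) (Metric.closedBall_mem_nhds _ hρ))

variable [IsRiemannianManifold 𝓘(ℝ, E) M]

lemma edist_le_of_isGeodesicAt {γ : ℝ → M} {a b : ℝ} (hab : a ≤ b)
    (h : ∀ t ∈ Icc a b, IsGeodesicAt E γ t) :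
    edist (γ a) (γ b) ≤ ‖velocity (E := E) γ a‖ₑ * ENNReal.ofReal (b - a) := by
  rw [← pathELength_eq_mul h]
  exact edist_le_pathELength_of_contMDiffOn hab fun t ht ↦
    ((h t ht).smooth.of_le (by simp)).contMDiffWithinAt

/-- Short geodesics minimize the distance between their endpoints: the energy of another curve,
parametrized almost proportionally to its length, is almost its squared length. -/
lemma exists_enorm_velocity_le_edist (x : M) : ∃ ρ > 0, ∃ r > 0, ∀ᶠ y in 𝓝 x, ∀ γ : ℝ → M,
    (∀ t ∈ Icc (0 : ℝ) 1, IsGeodesicAt E γ t ∧ γ t ∈ (extChartAt 𝓘(ℝ, E) x).source ∧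
      chartCurve E x γ t ∈ Metric.closedBall (extChartAt 𝓘(ℝ, E) x x) ρ ∧
      ‖deriv (chartCurve E x γ) t‖ ≤ r) → γ 0 = x → γ 1 = y →
    ‖velocity (E := E) γ 0‖ₑ ≤ edist x y := by
  obtain ⟨ρ, hρ, r, hr, hsub, hmin⟩ := (isMetricOn_chartForm x).exists_energy_le
    (mem_extChartAt_target (I := 𝓘(ℝ, E)) x)
  refine ⟨ρ, hρ, r, hr, ?_⟩
  obtain ⟨η, hη, hηs⟩ := EMetric.mem_nhds_iff.1 (eventually_mem_chart (E := E) x hρ)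
  filter_upwards [Metric.eball_mem_nhds x hη] with y hy γ hγ h0 h1
  have hy' : edist x y < η := by rwa [edist_comm]
  by_contra! hlt
  -- a curve of length less than `l` from `x` to `y`, which stays in the chart
  obtain ⟨l, hl1, hl2⟩ := ENNReal.lt_iff_exists_nnreal_btwn.1 (lt_min hlt hy')
  obtain ⟨σ, hσ0, hσ1, hσs, hσl, -⟩ := exists_lt_locally_constant_of_riemannianEDist_lt
    (by rwa [← IsRiemannianManifold.out (I := 𝓘(ℝ, E)) x y]) one_pos
  set v := chartCurve E x σ with hv
  have hση : ∀ t ∈ Icc (0 : ℝ) 1, σ t ∈ (extChartAt 𝓘(ℝ, E) x).source ∧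
      v t ∈ Metric.closedBall (extChartAt 𝓘(ℝ, E) x x) ρ := by
    intro t ht
    apply hηs
    rw [Metric.mem_eball, edist_comm]
    nth_rw 1 [← hσ0]
    calc edist (σ 0) (σ t) ≤ pathELength 𝓘(ℝ, E) σ 0 t :=
          edist_le_pathELength_of_contMDiffOn ht.1 hσs.contMDiffOn
      _ ≤ pathELength 𝓘(ℝ, E) σ 0 1 := by
          rw [← pathELength_add ht.1 ht.2]
          exact le_self_add
      _ < η := hσl.trans (hl2.trans_le (min_le_right _ _))
  have hvd : ∀ t ∈ Icc (0 : ℝ) 1, ContDiffAt ℝ 1 v t := fun t ht ↦ by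
    rw [← contMDiffAt_iff_contDiffAt]
    exact (contMDiffAt_extChartAt' (by simpa using (hση t ht).1)).comp t (hσs t)
  have hvd' : ∀ t ∈ Icc (0 : ℝ) 1, HasDerivAt v (deriv v t) t := fun t ht ↦
    ((hvd t ht).differentiableAt one_ne_zero).hasDerivAt
  have hvc : ContinuousOn (deriv v) (Icc 0 1) := fun t ht ↦ by
    have : ContDiffAt ℝ 0 (fderiv ℝ v) t := (hvd t ht).fderiv_right (by simp)
    exact (this.continuousAt.clm_apply continuousAt_const).continuousWithinAt
  have hGv : ContinuousOn (fun t ↦ chartForm x (v t)) (Icc 0 1) := fun t ht ↦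
    (((isMetricOn_chartForm x).contDiffAt (hsub (hση t ht).2)).continuousAt.comp
      (hvd t ht).continuousAt).continuousWithinAt
  set sp : ℝ → ℝ := fun t ↦ √(chartForm x (v t) (deriv v t) (deriv v t)) with hsp
  have hspc : ContinuousOn sp (Icc 0 1) := ((hGv.clm_apply hvc).clm_apply hvc).sqrt
  have hlen : (∫ t in (0 : ℝ)..1, sp t) < l := by
    have h2 : pathELength 𝓘(ℝ, E) σ 0 1 = ENNReal.ofReal (∫ t in (0 : ℝ)..1, sp t) := by
      rw [pathELength_eq_lintegral_velocity, intervalIntegral.integral_of_le zero_le_one,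
        ← MeasureTheory.integral_Icc_eq_integral_Ioc,
        MeasureTheory.ofReal_integral_eq_lintegral_ofReal (hspc.integrableOn_Icc)
          (Filter.Eventually.of_forall fun t ↦ Real.sqrt_nonneg _)]
      refine MeasureTheory.setLIntegral_congr_fun measurableSet_Icc fun t ht ↦ ?_
      exact enorm_velocity ((hσs t).mdifferentiableAt one_ne_zero) (hση t ht).1
    rw [h2, ENNReal.ofReal_lt_iff_lt_toReal
      (intervalIntegral.integral_nonneg zero_le_one fun t _ ↦ Real.sqrt_nonneg _) (by simp)] at hσl
    exact hσl
  obtain ⟨τ, τ', hτ, hτ'c, hτ0, hτ1, hτm, hτ'0, hτs⟩ := exists_reparametrization hspc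
    (fun t _ ↦ Real.sqrt_nonneg _) (sub_pos.2 hlen)
  have hτc : Continuous τ := continuous_iff_continuousAt.2 fun t ↦ (hτ t).continuousAt
  set u := chartCurve E x γ with hu
  have hud : ∀ t ∈ Icc (0 : ℝ) 1, ContDiffAt ℝ ∞ u t := fun t ht ↦
    contDiffAt_chartCurve (hγ t ht).1.smooth (hγ t ht).2.1
  have henergy := hmin u (deriv u) (deriv (deriv u)) (fun t ↦ v (τ t)) (fun t ↦ τ' t • deriv v (τ t))
    (fun t ht ↦ ((hud t ht).differentiableAt (by simp)).hasDerivAt)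
    (fun t ht ↦ ((hud t ht).deriv_infty.differentiableAt (by simp)).hasDerivAt)
    (fun t ht z ↦ (hγ t ht).1.equation x (hγ t ht).2.1 z)
    (fun t ht ↦ (hvd' (τ t) (hτm ht)).scomp t (hτ t))
    (hτ'c.continuousOn.smul (hvc.comp hτc.continuousOn hτm))
    (fun t ht ↦ (hγ t ht).2.2.1) (fun t ht ↦ (hση (τ t) (hτm ht)).2) (fun t ht ↦ (hγ t ht).2.2.2)
    (by simp only [hu, hv, chartCurve, h0, hτ0, hσ0]) (by simp only [hu, hv, chartCurve, h1, hτ1, hσ1])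
  have hE1 : ∫ t in (0 : ℝ)..1, chartForm x (u t) (deriv u t) (deriv u t)
      = ‖velocity (E := E) γ 0‖ ^ 2 := by
    rw [intervalIntegral.integral_congr (g := fun _ ↦ ‖velocity (E := E) γ 0‖ ^ 2)]
    · simp
    · intro t ht
      rw [uIcc_of_le zero_le_one] at ht
      rw [← norm_velocity_eq ht.1 fun s hs ↦ (hγ s ⟨hs.1, hs.2.trans ht.2⟩).1]
      exact (norm_velocity_sq (hγ t ht).1.eventually_mdifferentiableAt.self_of_nhds
        (hγ t ht).2.1).symm
  have hE2 : ∫ t in (0 : ℝ)..1, chartForm x (v (τ t)) (τ' t • deriv v (τ t))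
      (τ' t • deriv v (τ t)) ≤ (l : ℝ) ^ 2 := by
    have hb : ∀ t ∈ Ioc (0 : ℝ) 1, ‖chartForm x (v (τ t)) (τ' t • deriv v (τ t))
        (τ' t • deriv v (τ t))‖ ≤ (l : ℝ) ^ 2 := fun t ht ↦ by
      have ht' := Ioc_subset_Icc_self ht
      have hpos := (isMetricOn_chartForm x).nonneg (hsub (hση (τ t) (hτm ht')).2)
        (deriv v (τ t))
      have h2 := hτs t ht'
      rw [add_sub_cancel] at h2
      simp only [map_smul, smul_apply, smul_eq_mul]
      rw [Real.norm_of_nonneg (mul_nonneg (hτ'0 t) (mul_nonneg (hτ'0 t) hpos))]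
      calc τ' t * (τ' t * chartForm x (v (τ t)) (deriv v (τ t)) (deriv v (τ t)))
          = (sp (τ t) * τ' t) ^ 2 := by rw [mul_pow, hsp, Real.sq_sqrt hpos]; ring
        _ ≤ (l : ℝ) ^ 2 := by
          have := mul_nonneg (Real.sqrt_nonneg (chartForm x (v (τ t)) (deriv v (τ t))
            (deriv v (τ t)))) (hτ'0 t)
          gcongr
    have := intervalIntegral.norm_integral_le_of_norm_le_const (a := 0) (b := 1)
      (by rwa [uIoc_of_le zero_le_one])
    simpa using (Real.le_norm_self _).trans this
  have hE3 : ‖velocity (E := E) γ 0‖ ≤ l :=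
    (sq_le_sq₀ (norm_nonneg _) l.2).1 (hE1 ▸ henergy.trans hE2)
  refine absurd (hl2.trans_le (min_le_left _ _)) (not_lt.2 ?_)
  rw [← ofReal_norm, ← ENNReal.ofReal_coe_nnreal]
  exact ENNReal.ofReal_le_ofReal hE3

/-- In a geodesically complete manifold, the points close to `x` are joined to `x` by short
geodesics: in the chart at `x`, the exponential map is close to a translation. -/
lemma IsGeodesicallyComplete.eventually_exists_geodesic (H : IsGeodesicallyComplete E M) (x : M)
    {ρ r : ℝ} (hρ : 0 < ρ) (hr : 0 < r) : ∀ᶠ y in 𝓝 x, ∃ γ : ℝ → M,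
      (∀ t, IsGeodesicAt E γ t) ∧ γ 0 = x ∧ γ 1 = y ∧
      ∀ t ∈ Icc (0 : ℝ) 1, γ t ∈ (extChartAt 𝓘(ℝ, E) x).source ∧
        chartCurve E x γ t ∈ Metric.closedBall (extChartAt 𝓘(ℝ, E) x x) ρ ∧
        ‖deriv (chartCurve E x γ) t‖ ≤ r := by
  set x₀ := extChartAt 𝓘(ℝ, E) x x with hx₀
  have hmet := isMetricOn_chartForm (E := E) x
  have hx₀t := mem_extChartAt_target (I := 𝓘(ℝ, E)) x
  obtain ⟨ρ₀, hρ₀, c, hc, -, -, hsub, hcG, -, -⟩ := hmet.exists_bounds hx₀t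
  have hB := hmet.contDiffAt_connectionForm hx₀t
  obtain ⟨K₁, s, hs, hK₁⟩ := (hB.of_le (by simp)).exists_lipschitzOnWith
  set K : ℝ := max K₁ (‖connectionForm (chartForm x) x₀‖ + 1) with hK
  have hK1 : 1 ≤ K := (le_add_of_nonneg_left (norm_nonneg _)).trans (le_max_right _ _)
  have hBb : ∀ᶠ y in 𝓝 x₀, ‖connectionForm (chartForm x) y‖ < ‖connectionForm (chartForm x) x₀‖ + 1 :=
    hB.continuousAt.norm.eventually_lt_const (by linarith)
  obtain ⟨ρ₁, hρ₁, hball⟩ := Metric.nhds_basis_closedBall.mem_iff.1 (Filter.inter_mem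
    (Filter.inter_mem hs hBb) (Filter.inter_mem (Metric.closedBall_mem_nhds x₀ hρ₀)
      (Metric.closedBall_mem_nhds x₀ hρ)))
  -- with this bound on the velocities, `K * r₁ ^ 2 + 2 * K * r₁ ≤ 1 / 4`
  set r₁ : ℝ := min r (1 / (12 * K)) with hr₁
  have hr₁0 : 0 < r₁ := by positivity
  have hKr : K * r₁ ≤ 1 / 12 := by
    have : r₁ ≤ 1 / (12 * K) := min_le_right _ _
    rw [le_div_iff₀ (by positivity)] at this
    linarith
  have hr₁1 : r₁ ≤ 1 / 12 := by nlinarith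
  obtain ⟨η, hη, hηs⟩ := EMetric.mem_nhds_iff.1 (eventually_mem_chart (E := E) x hρ₁)
  -- the initial velocities `v` with a small speed
  have hsmall : ∀ᶠ v : E in 𝓝 0, ENNReal.ofReal (√(chartForm x x₀ v v)) < η ∧
      chartForm x x₀ v v < c * r₁ ^ 2 := by
    have h1 : Continuous fun v : E ↦ chartForm x x₀ v v := by fun_prop
    refine Filter.Eventually.and ?_ ?_
    · refine (ENNReal.continuous_ofReal.comp h1.sqrt).continuousAt.eventually_lt_const ?_
      simpa using hη
    · refine h1.continuousAt.eventually_lt_const ?_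
      simp only [map_zero]
      positivity
  obtain ⟨r₂, hr₂, hr₂s⟩ := Metric.nhds_basis_closedBall.mem_iff.1 hsmall
  choose g hg hg0 hg1 using H.exists_isGeodesicAt x
  have hspeed (v : E) : ‖velocity (E := E) (g v) 0‖ ^ 2 = chartForm x x₀ v v := by
    rw [norm_velocity_sq (p := x) (hg v 0).eventually_mdifferentiableAt.self_of_nhds
      (by rw [hg0]; exact mem_extChartAt_source x), hg1, chartCurve, hg0]
  have hprop : ∀ v ∈ Metric.closedBall (0 : E) r₂, ∀ t ∈ Icc (0 : ℝ) 1,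
      g v t ∈ (extChartAt 𝓘(ℝ, E) x).source ∧
      chartCurve E x (g v) t ∈ Metric.closedBall x₀ ρ₁ ∧ ‖deriv (chartCurve E x (g v)) t‖ ≤ r₁ := by
    intro v hv t ht
    obtain ⟨h1, h2⟩ := hr₂s hv
    have h3 : g v t ∈ (extChartAt 𝓘(ℝ, E) x).source ∧
        chartCurve E x (g v) t ∈ Metric.closedBall x₀ ρ₁ := by
      apply hηs
      rw [Metric.mem_eball, edist_comm]
      nth_rw 1 [← hg0 v]
      calc edist (g v 0) (g v t) ≤ ‖velocity (E := E) (g v) 0‖ₑ * ENNReal.ofReal (t - 0) :=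
            edist_le_of_isGeodesicAt ht.1 fun s _ ↦ hg v s
        _ ≤ ‖velocity (E := E) (g v) 0‖ₑ * 1 := by
            gcongr
            rw [ENNReal.ofReal_le_one]
            linarith [ht.2]
        _ < η := by
            rwa [mul_one, ← ofReal_norm, ← Real.sqrt_sq (norm_nonneg (velocity (E := E) (g v) 0)),
              hspeed]
    refine ⟨h3.1, h3.2, ?_⟩
    have h4 := hcG _ (hball h3.2).2.1 (deriv (chartCurve E x (g v)) t)
    rw [← norm_velocity_sq (hg v t).eventually_mdifferentiableAt.self_of_nhds h3.1,
      norm_velocity_eq ht.1 (fun s _ ↦ hg v s), hspeed] at h4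
    have h5 := le_of_mul_le_mul_left (h4.trans h2.le) hc
    exact (sq_le_sq₀ (norm_nonneg _) hr₁0.le).1 h5
  -- in the chart, the exponential map is close to a translation, hence locally surjective
  have happrox : ApproximatesLinearOn (fun v ↦ chartCurve E x (g v) 1) (.id ℝ E)
      (Metric.closedBall 0 r₂) (1 / 2) := by
    intro v hv w hw
    have hode {v : E} (hv : v ∈ Metric.closedBall (0 : E) r₂) {t : ℝ} (ht : t ∈ Icc (0 : ℝ) 1) :
        HasDerivAt (chartCurve E x (g v)) (deriv (chartCurve E x (g v)) t) t ∧
        HasDerivAt (deriv (chartCurve E x (g v))) (- connectionForm (chartForm x)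
          (chartCurve E x (g v) t) (deriv (chartCurve E x (g v)) t)
          (deriv (chartCurve E x (g v)) t)) t := by
      have h1 := (hprop v hv t ht).1
      have h2 := contDiffAt_chartCurve (hg v t).smooth h1
      refine ⟨(h2.differentiableAt (by simp)).hasDerivAt, ?_⟩
      rw [← (hmet.geodesicEq_iff (chartCurve_mem_target h1)).1 ((hg v t).equation x h1)]
      exact (h2.deriv_infty.differentiableAt (by simp)).hasDerivAt
    have := norm_endpoint_sub_le (B := connectionForm (chartForm x)) (s := Metric.closedBall x₀ ρ₁)
      (K := K) (r := r₁) (by linarith) hr₁0.le (by nlinarith)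
      (fun y hy ↦ (hball hy).1.2.le.trans (le_max_right _ _))
      (fun y hy z hz ↦ by
        rw [← dist_eq_norm, ← dist_eq_norm]
        exact (hK₁.dist_le_mul y (hball hy).1.1 z (hball hz).1.1).trans
          (by gcongr; exact le_max_left _ _))
      (fun t ht ↦ (hode hv ht).1) (fun t ht ↦ (hode hv ht).2)
      (fun t ht ↦ (hode hw ht).1) (fun t ht ↦ (hode hw ht).2)
      (fun t ht ↦ (hprop v hv t ht).2.1) (fun t ht ↦ (hprop w hw t ht).2.1)
      (fun t ht ↦ (hprop v hv t ht).2.2) (fun t ht ↦ (hprop w hw t ht).2.2)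
      (by simp only [chartCurve, hg0])
    rw [hg1, hg1] at this
    simpa using this
  have hsurj := happrox.surjOn_closedBall_of_nonlinearRightInverse
    ⟨id, 1, fun y ↦ by simp, fun y ↦ rfl⟩ hr₂.le subset_rfl
  have hf0 : chartCurve E x (g 0) 1 = x₀ := by
    have h1 := edist_le_of_isGeodesicAt zero_le_one fun s _ ↦ hg 0 s
    have h2 := hspeed 0
    simp only [map_zero] at h2
    have h3 : ‖velocity (E := E) (g 0) 0‖ₑ = 0 := by
      rw [← ofReal_norm, pow_eq_zero_iff two_ne_zero |>.1 h2, ENNReal.ofReal_zero]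
    rw [h3, zero_mul, nonpos_iff_eq_zero, edist_eq_zero, hg0] at h1
    rw [chartCurve, ← h1]
  have hr₂' : 0 < (((1 : NNReal) : ℝ)⁻¹ - ((1 / 2 : NNReal) : ℝ)) * r₂ := by
    refine mul_pos ?_ hr₂
    norm_num
  filter_upwards [eventually_mem_chart (E := E) x hr₂'] with y hy
  obtain ⟨v, hv, hvy⟩ := hsurj (show extChartAt 𝓘(ℝ, E) x y ∈ _ by rw [hf0]; exact hy.2)
  refine ⟨g v, hg v, hg0 v, (extChartAt 𝓘(ℝ, E) x).injOn
    (hprop v hv 1 ⟨zero_le_one, le_rfl⟩).1 hy.1 hvy, fun t ht ↦ ?_⟩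
  obtain ⟨h1, h2, h3⟩ := hprop v hv t ht
  exact ⟨h1, (hball h2).2.2, h3.trans (min_le_left _ _)⟩

/-- In a geodesically complete manifold, the points close to `x` are joined to `x` by minimizing
geodesics. -/
lemma IsGeodesicallyComplete.eventually_exists_minimizing (H : IsGeodesicallyComplete E M) (x : M) :
    ∀ᶠ y in 𝓝 x, ∃ γ : ℝ → M, (∀ t, IsGeodesicAt E γ t) ∧ γ 0 = x ∧ γ 1 = y ∧
      ‖velocity (E := E) γ 0‖ₑ = edist x y := by
  obtain ⟨ρ, hρ, r, hr, hmin⟩ := exists_enorm_velocity_le_edist (E := E) x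
  filter_upwards [hmin, H.eventually_exists_geodesic x hρ hr] with y hy hγ
  obtain ⟨γ, hγ, h0, h1, h2⟩ := hγ
  refine ⟨γ, hγ, h0, h1, le_antisymm (hy γ (fun t ht ↦ ⟨hγ t, h2 t ht⟩) h0 h1) ?_⟩
  have := edist_le_of_isGeodesicAt zero_le_one fun s _ ↦ hγ s
  simpa [h0, h1] using this

end Minimality

/-! ### The Hopf–Rinow argument -/

/-- For small radii `δ`, if `f` is the distance to an ideal point (the limit of an ultrafilter `l`),
the minimum of `f` on the sphere of radius `δ` around `x` is at most `f x - δ`, since paths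
from `x` to points far along `l` cross this sphere. -/
lemma eventually_exists_edist_eq
    (E : Type*) [NormedAddCommGroup E] [NormedSpace ℝ E] [FiniteDimensional ℝ E]
    {M : Type*} [EMetricSpace M] [ChartedSpace E M] [IsManifold 𝓘(ℝ, E) ∞ M]
    [RiemannianBundle (fun x : M ↦ TangentSpace 𝓘(ℝ, E) x)]
    [IsContMDiffRiemannianBundle 𝓘(ℝ, E) ∞ E (fun x : M ↦ TangentSpace 𝓘(ℝ, E) x)]
    [IsRiemannianManifold 𝓘(ℝ, E) M] {l : Ultrafilter M} {f : M → ℝ≥0∞}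
    (hf : ∀ x, Filter.Tendsto (fun z ↦ edist x z) l (𝓝 (f x)))
    (hf0 : ∀ ε > 0, ∀ᶠ z in (l : Filter M), f z ≤ ε) (hfe : ∀ x y, f x ≤ f y + edist x y)
    (hfc : Continuous f) {x : M} (hx0 : 0 < f x) (hx : f x ≠ ⊤) :
    ∀ᶠ δ in 𝓝[>] (0 : ℝ), ∃ y, edist x y = ENNReal.ofReal δ ∧ f y + ENNReal.ofReal δ ≤ f x := by
  have : LocallyCompactSpace M := Manifold.locallyCompact_of_finiteDimensional 𝓘(ℝ, E)
  obtain ⟨K, hK, hxK⟩ := exists_compact_mem_nhds x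
  obtain ⟨η, hη, hηK⟩ := EMetric.mem_nhds_iff.1 hxK
  have hofReal : Filter.Tendsto ENNReal.ofReal (𝓝[>] 0) (𝓝 0) := by
    simpa using (ENNReal.continuous_ofReal.tendsto 0).mono_left nhdsWithin_le_nhds
  filter_upwards [hofReal.eventually_lt_const hη, hofReal.eventually_lt_const hx0] with δ hδη hδx
  set d := ENNReal.ofReal δ with hd
  have hcross : ∀ ε : ℝ≥0∞, 0 < ε → ∃ y, edist x y = d ∧ f y + d ≤ f x + ε := by
    intro ε hε
    obtain ⟨ε', hε', hεε⟩ : ∃ ε' > 0, ε' + ε' ≤ ε := ⟨ε / 2, ENNReal.half_pos hε.ne', by simp⟩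
    have hlt : f x < f x + ε' := ENNReal.lt_add_right hx hε'.ne'
    obtain ⟨z, hz1, hz2, hz3⟩ := ((hf x).eventually_lt_const hlt |>.and
      (((hf x).eventually_const_lt hδx).and (hf0 ε' hε'))).exists
    obtain ⟨σ, hσ0, hσ1, hσs, hσl, -⟩ := exists_lt_locally_constant_of_riemannianEDist_lt
      (by rwa [← IsRiemannianManifold.out (I := 𝓘(ℝ, E)) x z]) one_pos
    have hcont : Continuous fun t ↦ edist x (σ t) := continuous_const.edist hσs.continuous
    obtain ⟨t, ht, htd⟩ := intermediate_value_Icc zero_le_one hcont.continuousOn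
      (show d ∈ Icc (edist x (σ 0)) (edist x (σ 1)) by
        rw [hσ0, hσ1, edist_self]
        exact ⟨zero_le, hz2.le⟩)
    refine ⟨σ t, htd, ?_⟩
    have h1 : edist (σ t) z ≤ pathELength 𝓘(ℝ, E) σ t 1 := by
      rw [← hσ1]
      exact edist_le_pathELength_of_contMDiffOn ht.2 hσs.contMDiffOn
    have h2 : d ≤ pathELength 𝓘(ℝ, E) σ 0 t := by
      rw [← htd]
      nth_rw 1 [← hσ0]
      exact edist_le_pathELength_of_contMDiffOn ht.1 hσs.contMDiffOn
    calc f (σ t) + d ≤ (f z + edist (σ t) z) + d := by gcongr; exact hfe _ _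
      _ ≤ (ε' + pathELength 𝓘(ℝ, E) σ t 1) + pathELength 𝓘(ℝ, E) σ 0 t := by gcongr
      _ = ε' + pathELength 𝓘(ℝ, E) σ 0 1 := by
        rw [← pathELength_add ht.1 ht.2]
        ring
      _ ≤ ε' + (f x + ε') := by gcongr
      _ = f x + (ε' + ε') := by ring
      _ ≤ f x + ε := by gcongr
  have hS : IsCompact {y | edist x y = d} := by
    refine hK.of_isClosed_subset (isClosed_eq (continuous_const.edist continuous_id)
      continuous_const) fun y hy ↦ hηK ?_
    rw [Metric.mem_eball, edist_comm]
    exact (show edist x y = d from hy).trans_lt hδη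
  obtain ⟨y₁, hy₁, -⟩ := hcross 1 one_pos
  obtain ⟨y, hy, hmin⟩ := hS.exists_isMinOn ⟨y₁, hy₁⟩ hfc.continuousOn
  refine ⟨y, hy, ENNReal.le_of_forall_pos_le_add fun ε hε _ ↦ ?_⟩
  obtain ⟨z, hz, hzf⟩ := hcross ε (by exact_mod_cast hε)
  exact (add_le_add_left (hmin hz) d).trans hzf

section HopfRinow

variable {E : Type*} [NormedAddCommGroup E] [NormedSpace ℝ E] [FiniteDimensional ℝ E]
  {M : Type*} [EMetricSpace M] [ChartedSpace E M] [IsManifold 𝓘(ℝ, E) ∞ M]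
  [RiemannianBundle (fun x : M ↦ TangentSpace 𝓘(ℝ, E) x)]
  [IsContMDiffRiemannianBundle 𝓘(ℝ, E) ∞ E (fun x : M ↦ TangentSpace 𝓘(ℝ, E) x)]

lemma norm_velocity_comp_affine {γ : ℝ → M} (hγ : ∀ t, IsGeodesicAt E γ t) {a : ℝ} (ha : 0 ≤ a) :
    ‖velocity (E := E) (fun s ↦ γ (a * s + 0)) 0‖ = a * ‖velocity (E := E) γ 0‖ := by
  have hs : γ 0 ∈ (extChartAt 𝓘(ℝ, E) (γ 0)).source := mem_extChartAt_source (γ 0)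
  have h0 : γ (a * 0 + 0) = γ 0 := by simp
  rw [← sq_eq_sq₀ (norm_nonneg _) (by positivity), mul_pow,
    norm_velocity_sq (p := γ 0) (hγ 0).eventually_mdifferentiableAt.self_of_nhds hs,
    norm_velocity_sq (p := γ 0) (c := fun s ↦ γ (a * s + 0))
      (IsGeodesicAt.comp_affine (hγ _)).eventually_mdifferentiableAt.self_of_nhds (by rwa [h0])]
  have h1 : chartCurve E (γ 0) (fun s ↦ γ (a * s + 0))
      = fun s ↦ chartCurve E (γ 0) γ (a * s + 0) := rfl
  rw [h1, deriv_comp_affine, mul_zero, add_zero]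
  simp only [map_smul, smul_apply, smul_eq_mul, mul_zero, add_zero]
  ring

variable [IsRiemannianManifold 𝓘(ℝ, E) M]

/-- A minimizing curve made of two unit speed curves has no corner. -/
lemma deriv_chartCurve_eq_of_minimizing {γ σ : ℝ → M} {t₀ : ℝ}
    (hγ : MDifferentiableAt 𝓘(ℝ, ℝ) 𝓘(ℝ, E) γ t₀) (hσ : MDifferentiableAt 𝓘(ℝ, ℝ) 𝓘(ℝ, E) σ 0)
    (h0 : σ 0 = γ t₀) (hγ1 : ‖velocity (E := E) γ t₀‖ = 1) (hσ1 : ‖velocity (E := E) σ 0‖ = 1)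
    (hmin : ∀ᶠ s in 𝓝[>] (0 : ℝ), ENNReal.ofReal (2 * s) ≤ edist (γ (t₀ - s)) (σ s)) :
    deriv (chartCurve E (γ t₀) σ) 0 = deriv (chartCurve E (γ t₀) γ) t₀ := by
  set p := γ t₀ with hp
  set x₀ := extChartAt 𝓘(ℝ, E) p p with hx₀
  have hps : p ∈ (extChartAt 𝓘(ℝ, E) p).source := mem_extChartAt_source p
  have hmet := isMetricOn_chartForm (E := E) p
  have hx₀t : x₀ ∈ (extChartAt 𝓘(ℝ, E) p).target := mem_extChartAt_target (I := 𝓘(ℝ, E)) p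
  set u := chartCurve E p γ with hu
  set w := chartCurve E p σ with hw
  have hu0 : u t₀ = x₀ := rfl
  have hw0 : w 0 = x₀ := by rw [hw, chartCurve, h0]
  set a := deriv u t₀ with ha
  set b := deriv w 0 with hb
  have hua : HasDerivAt u a t₀ := (hasDerivAt_chartCurve hγ hps).differentiableAt.hasDerivAt
  have hwb : HasDerivAt w b 0 :=
    (hasDerivAt_chartCurve hσ (by rw [h0]; exact hps)).differentiableAt.hasDerivAt
  have haa : chartForm p x₀ a a = 1 := by
    rw [← hu0, ha, ← norm_velocity_sq hγ hps, hγ1, one_pow]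
  have hbb : chartForm p x₀ b b = 1 := by
    rw [← hw0, hb, ← norm_velocity_sq hσ (by rw [h0]; exact hps), hσ1, one_pow]
  -- `g` is the difference of the two curves in the chart, at times `t₀ - s` and `s`
  set g : ℝ → E := fun s ↦ w s - u (t₀ - s) with hg
  have hus : HasDerivAt (fun s ↦ u (t₀ - s)) (-a) 0 := by
    have h1 : HasDerivAt u a (t₀ - 0) := by rwa [sub_zero]
    have h2 : HasDerivAt (fun s ↦ u (t₀ - s)) ((-1 : ℝ) • a) 0 :=
      h1.scomp (0 : ℝ) ((hasDerivAt_id (0 : ℝ)).const_sub t₀)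
    rwa [neg_one_smul] at h2
  have hgd : HasDerivAt g (a + b) 0 := by
    have := hwb.sub hus
    rwa [sub_neg_eq_add, add_comm] at this
  have hg0 : g 0 = 0 := by simp [hg, hw0, hu0]
  have hslope : Filter.Tendsto (fun s ↦ s⁻¹ • g s) (𝓝[>] 0) (𝓝 (a + b)) := by
    have := hgd.tendsto_slope_zero_right
    simpa [hg0] using this
  have hlim : Filter.Tendsto (fun s ↦ chartForm p x₀ (s⁻¹ • g s) (s⁻¹ • g s)) (𝓝[>] 0)
      (𝓝 (chartForm p x₀ (a + b) (a + b))) := by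
    have h1 : Continuous fun v : E ↦ chartForm p x₀ v v := by fun_prop
    exact (h1.tendsto _).comp hslope
  -- comparing the distance `2 * s` with the length of a segment in the chart, for `s → 0`
  have key : ∀ k : ℝ, 1 < k → 4 ≤ k * chartForm p x₀ (a + b) (a + b) := by
    intro k hk
    obtain ⟨ρ, hρ, hsub, hcomp⟩ := hmet.exists_comparison hx₀t hk
    have hnear : ∀ᶠ s in 𝓝 (0 : ℝ), (σ s ∈ (extChartAt 𝓘(ℝ, E) p).source ∧
        w s ∈ Metric.ball x₀ ρ) ∧ γ (t₀ - s) ∈ (extChartAt 𝓘(ℝ, E) p).source ∧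
        u (t₀ - s) ∈ Metric.ball x₀ ρ := by
      have hsrc : (extChartAt 𝓘(ℝ, E) p).source ∈ 𝓝 p := extChartAt_source_mem_nhds (I := 𝓘(ℝ, E)) p
      have ht : Filter.Tendsto (fun s ↦ t₀ - s) (𝓝 (0 : ℝ)) (𝓝 t₀) := by
        have : Continuous fun s : ℝ ↦ t₀ - s := by fun_prop
        simpa using this.tendsto 0
      have hball : Metric.ball x₀ ρ ∈ 𝓝 x₀ := Metric.ball_mem_nhds _ hρ
      exact Filter.inter_mem (Filter.inter_mem (hσ.continuousAt (by rwa [h0]))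
        (hwb.continuousAt (by rwa [hw0])))
        (Filter.inter_mem (ht (hγ.continuousAt hsrc)) (ht (show u ⁻¹' Metric.ball x₀ ρ ∈ 𝓝 t₀ from
          hua.continuousAt (by rwa [hu0]))))
    refine ge_of_tendsto (hlim.const_mul k) ?_
    filter_upwards [hmin, nhdsWithin_le_nhds hnear, self_mem_nhdsWithin] with s hs1 hs2 hs3
    obtain ⟨⟨h1, h2⟩, h3, h4⟩ := hs2
    have hs0 : 0 < s := hs3
    have hseg : segment ℝ (u (t₀ - s)) (w s) ⊆ Metric.ball x₀ ρ :=
      (convex_ball x₀ ρ).segment_subset h4 h2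
    have hpos : 0 ≤ k * chartForm p x₀ (g s) (g s) :=
      mul_nonneg (by linarith) (hmet.nonneg hx₀t _)
    have h5 := edist_symm_le_of_segment (p := p) (a := u (t₀ - s)) (b := w s)
      (K := √(k * chartForm p x₀ (g s) (g s))) (Real.sqrt_nonneg _) (hseg.trans hsub)
      (fun z hz ↦ by
        rw [Real.sq_sqrt hpos]
        exact (hcomp z (hseg hz) _).1)
    rw [hu, hw, chartCurve, chartCurve, (extChartAt 𝓘(ℝ, E) p).left_inv h3,
      (extChartAt 𝓘(ℝ, E) p).left_inv h1] at h5
    have h6 := (ENNReal.ofReal_le_ofReal_iff (Real.sqrt_nonneg _)).1 (hs1.trans h5)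
    rw [Real.le_sqrt (by linarith) hpos] at h6
    simp only [map_smul, smul_apply, smul_eq_mul]
    have h7 : k * (s⁻¹ * (s⁻¹ * chartForm p x₀ (g s) (g s)))
        = k * chartForm p x₀ (g s) (g s) / s ^ 2 := by field_simp
    rw [h7, le_div_iff₀ (by positivity)]
    linarith
  have h4 : 4 ≤ chartForm p x₀ (a + b) (a + b) := by
    refine le_of_tendsto_of_tendsto (b := 𝓝[>] (1 : ℝ)) tendsto_const_nhds
      (g := fun k ↦ k * chartForm p x₀ (a + b) (a + b)) ?_ ?_
    · have : Continuous fun k : ℝ ↦ k * chartForm p x₀ (a + b) (a + b) := by fun_prop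
      simpa using (this.tendsto 1).mono_left nhdsWithin_le_nhds
    · filter_upwards [self_mem_nhdsWithin] with k hk using key k hk
  -- `G (a + b, a + b) ≥ 4` for unit vectors means `G (b - a, b - a) ≤ 0`
  by_contra hne
  have h5 := hmet.pos x₀ hx₀t (b - a) (sub_ne_zero.2 hne)
  have h6 := hmet.symm x₀ a b
  simp only [map_add, add_apply] at h4
  simp only [map_sub, sub_apply] at h5
  linarith

/-- In a geodesically complete manifold, the distance to an ideal point decreases at unit rate
along some unit speed geodesic starting at `x`, for a short time. -/
lemma IsGeodesicallyComplete.exists_geodesic_toward (H : IsGeodesicallyComplete E M)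
    {l : Ultrafilter M} {f : M → ℝ≥0∞}
    (hf : ∀ x, Filter.Tendsto (fun z ↦ edist x z) l (𝓝 (f x)))
    (hf0 : ∀ ε > 0, ∀ᶠ z in (l : Filter M), f z ≤ ε) (hfe : ∀ x y, f x ≤ f y + edist x y)
    (hfc : Continuous f) {x : M} (hx0 : 0 < f x) (hx : f x ≠ ⊤) :
    ∃ γ : ℝ → M, (∀ t, IsGeodesicAt E γ t) ∧ γ 0 = x ∧ (∀ t, ‖velocity (E := E) γ t‖ = 1) ∧
      ∃ δ > 0, ∀ s ∈ Icc 0 δ, f (γ s) + ENNReal.ofReal s ≤ f x := by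
  obtain ⟨η, hη, hηs⟩ := EMetric.mem_nhds_iff.1 (H.eventually_exists_minimizing x)
  have hofReal : Filter.Tendsto ENNReal.ofReal (𝓝[>] 0) (𝓝 0) := by
    simpa using (ENNReal.continuous_ofReal.tendsto 0).mono_left nhdsWithin_le_nhds
  obtain ⟨δ, ⟨y, hy, hfy⟩, hδη, hδ⟩ := ((eventually_exists_edist_eq E hf hf0 hfe hfc hx0
    hx).and ((hofReal.eventually_lt_const hη).and self_mem_nhdsWithin)).exists
  have hδ0 : 0 < δ := hδ
  obtain ⟨γ, hγ, h0, h1, hsp⟩ := hηs (show y ∈ _ by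
    rw [Metric.mem_eball, edist_comm, hy]
    exact hδη)
  have hsp' : ‖velocity (E := E) γ 0‖ = δ := by
    rw [hy, ← ofReal_norm] at hsp
    exact (ENNReal.ofReal_eq_ofReal_iff (norm_nonneg _) hδ0.le).1 hsp
  set σ : ℝ → M := fun s ↦ γ (δ⁻¹ * s + 0) with hσ
  have hσg : ∀ t, IsGeodesicAt E σ t := fun t ↦ IsGeodesicAt.comp_affine (hγ _)
  have hσ1 : ∀ t, ‖velocity (E := E) σ t‖ = 1 := fun t ↦ by
    have h2 : ‖velocity (E := E) σ 0‖ = 1 := by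
      rw [hσ, norm_velocity_comp_affine hγ (by positivity), hsp', inv_mul_cancel₀ hδ0.ne']
    rcases le_total 0 t with ht | ht
    · rw [norm_velocity_eq ht fun s _ ↦ hσg s, h2]
    · rw [← norm_velocity_eq ht fun s _ ↦ hσg s, h2]
  refine ⟨σ, hσg, by simp [hσ, h0], hσ1, δ, hδ0, fun s hs ↦ ?_⟩
  have hσδ : σ δ = y := by simp [hσ, hδ0.ne', h1]
  have h3 : edist (σ s) y ≤ ENNReal.ofReal (δ - s) := by
    have := edist_le_of_isGeodesicAt hs.2 fun r _ ↦ hσg r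
    rwa [hσδ, ← ofReal_norm, hσ1, ENNReal.ofReal_one, one_mul] at this
  calc f (σ s) + ENNReal.ofReal s ≤ (f y + ENNReal.ofReal (δ - s)) + ENNReal.ofReal s := by
        gcongr
        exact (hfe _ _).trans (by gcongr)
    _ = f y + ENNReal.ofReal δ := by
        rw [add_assoc, ← ENNReal.ofReal_add (by linarith [hs.2]) hs.1, sub_add_cancel]
    _ ≤ f x := hfy

/-- The Hopf–Rinow argument: a unit speed geodesic that points toward an ideal point of the
manifold reaches it, so the ideal point is a point of the manifold. -/
theorem IsGeodesicallyComplete.completeSpace (H : IsGeodesicallyComplete E M) :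
    CompleteSpace M := by
  rw [completeSpace_iff_ultrafilter]
  intro l hl
  -- the distance to the ideal point
  have hlim (x : M) : ∃ a : ℝ≥0∞, Filter.Tendsto (fun z ↦ edist x z) l (𝓝 a) := by
    obtain ⟨a, -, ha⟩ := isCompact_univ.ultrafilter_le_nhds (l.map fun z ↦ edist x z) (by simp)
    exact ⟨a, ha⟩
  choose f hf using hlim
  have hfe : ∀ x y, f x ≤ f y + edist x y := fun x y ↦
    le_of_tendsto_of_tendsto' (hf x) ((hf y).add_const _) fun z ↦ by
      rw [add_comm]
      exact edist_triangle x y z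
  have hfc : Continuous f := continuous_of_le_add_edist 1 (by simp) (by simpa using hfe)
  have hf0 : ∀ ε > 0, ∀ᶠ z in (l : Filter M), f z ≤ ε := by
    intro ε hε
    obtain ⟨s, hs, hsε⟩ := (EMetric.cauchy_iff.1 hl).2 ε hε
    filter_upwards [hs] with z hz
    refine le_of_tendsto (hf z) ?_
    filter_upwards [hs] with y hy using (hsε z hz y hy).le
  suffices h : ∃ x, f x = 0 by
    obtain ⟨x, hx⟩ := h
    refine ⟨x, ?_⟩
    have := hf x
    rw [hx] at this
    have h2 : Filter.Tendsto id (l : Filter M) (𝓝 x) :=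
      tendsto_iff_edist_tendsto_0.2 (by simpa only [id, edist_comm x] using this)
    exact h2
  obtain ⟨p, hp⟩ : ∃ p, f p ≠ ⊤ := by
    obtain ⟨p, hp⟩ := (hf0 1 one_pos).exists
    exact ⟨p, ne_top_of_le_ne_top (by simp) hp⟩
  rcases (zero_le : 0 ≤ f p).eq_or_lt with hp0 | hp0
  · exact ⟨p, hp0.symm⟩
  obtain ⟨γ, hγ, hγ0, hγ1, δ, hδ, hγδ⟩ := H.exists_geodesic_toward hf hf0 hfe hfc hp0 hp
  have hdist {σ : ℝ → M} (hσ : ∀ t, IsGeodesicAt E σ t) (hσ1 : ∀ t, ‖velocity (E := E) σ t‖ = 1)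
      {a b : ℝ} (hab : a ≤ b) : edist (σ a) (σ b) ≤ ENNReal.ofReal (b - a) := by
    have := edist_le_of_isGeodesicAt hab fun r _ ↦ hσ r
    rwa [← ofReal_norm, hσ1, ENNReal.ofReal_one, one_mul] at this
  set D := (f p).toReal with hD
  have hfD : f p = ENNReal.ofReal D := (ENNReal.ofReal_toReal hp).symm
  have hγc : Continuous γ := continuous_iff_continuousAt.2 fun t ↦ (hγ t).smooth.continuousAt
  have hsub : Icc 0 D ⊆ {t | f (γ t) + ENNReal.ofReal t ≤ f p} := by
    refine IsClosed.Icc_subset_of_forall_exists_gt ?_ ?_ ?_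
    · exact (isClosed_le ((hfc.comp hγc).add ENNReal.continuous_ofReal) continuous_const).inter
        isClosed_Icc
    · simp [hγ0]
    rintro t ⟨htS, ht0, htD⟩ y hy
    have hty : t < y := hy
    have htS' : f (γ t) + ENNReal.ofReal t ≤ f p := htS
    -- the unit rate persists for a short time after `t`
    suffices h : ∀ᶠ s in 𝓝[>] (0 : ℝ), f (γ (s + t)) + ENNReal.ofReal (s + t) ≤ f p by
      obtain ⟨s, hs, hs0, hsy⟩ := (h.and (Ioo_mem_nhdsGT (sub_pos.2 hty))).exists
      exact ⟨s + t, hs, by linarith, by linarith⟩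
    rcases ht0.eq_or_lt with rfl | ht0
    · filter_upwards [Ioo_mem_nhdsGT hδ] with s hs
      rw [add_zero]
      exact hγδ s ⟨hs.1.le, hs.2.le⟩
    have hfx : f (γ t) ≠ ⊤ := ne_top_of_le_ne_top hp (le_self_add.trans htS')
    have hfx0 : 0 < f (γ t) := by
      by_contra! hcon
      have h1 := hfe p (γ t)
      have h2 := hdist hγ hγ1 ht0.le
      rw [hγ0, sub_zero] at h2
      rw [nonpos_iff_eq_zero.1 hcon, zero_add, hfD] at h1
      have := (ENNReal.ofReal_le_ofReal_iff ht0.le).1 (h1.trans h2)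
      linarith
    obtain ⟨σ, hσ, hσ0, hσ1, δ', hδ', hσδ⟩ := H.exists_geodesic_toward hf hf0 hfe hfc hfx0 hfx
    -- the concatenation of `γ` up to time `t` and `σ` is minimizing
    have hmin : ∀ᶠ s in 𝓝[>] (0 : ℝ), ENNReal.ofReal (2 * s) ≤ edist (γ (t - s)) (σ s) := by
      filter_upwards [Ioo_mem_nhdsGT hδ', Ioo_mem_nhdsGT ht0] with s hs hst
      have hfs : f (σ s) ≠ ⊤ :=
        ne_top_of_le_ne_top hfx (le_self_add.trans (hσδ s ⟨hs.1.le, hs.2.le⟩))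
      have h1 : f (σ s) + (ENNReal.ofReal (2 * s) + ENNReal.ofReal (t - s))
          ≤ f (σ s) + (edist (γ (t - s)) (σ s) + ENNReal.ofReal (t - s)) := by
        calc f (σ s) + (ENNReal.ofReal (2 * s) + ENNReal.ofReal (t - s))
            = f (σ s) + ENNReal.ofReal s + ENNReal.ofReal t := by
              rw [← ENNReal.ofReal_add (by linarith [hs.1]) (by linarith [hst.2]), add_assoc,
                ← ENNReal.ofReal_add hs.1.le ht0.le]
              congr 2
              ring
          _ ≤ f (γ t) + ENNReal.ofReal t := by gcongr; exact hσδ s ⟨hs.1.le, hs.2.le⟩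
          _ ≤ f p := htS'
          _ ≤ f (γ (t - s)) + edist p (γ (t - s)) := hfe _ _
          _ ≤ (f (σ s) + edist (γ (t - s)) (σ s)) + ENNReal.ofReal (t - s) := by
              gcongr
              · exact hfe _ _
              · have := hdist hγ hγ1 (sub_nonneg.2 hst.2.le)
                rwa [hγ0, sub_zero] at this
          _ = _ := by rw [add_assoc]
      exact ENNReal.le_of_add_le_add_right (by simp) (ENNReal.le_of_add_le_add_left hfs h1)
    have hderiv := deriv_chartCurve_eq_of_minimizing
      (hγ t).eventually_mdifferentiableAt.self_of_nhds
      (hσ 0).eventually_mdifferentiableAt.self_of_nhds hσ0 (hγ1 t) (hσ1 0) hmin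
    have heq : (fun s ↦ γ (1 * s + t)) =ᶠ[𝓝 0] σ := by
      refine IsGeodesicAt.eventuallyEq (p := γ t) (by simp)
        (Filter.Eventually.of_forall fun s ↦ IsGeodesicAt.comp_affine (hγ _))
        (Filter.Eventually.of_forall hσ) (by simp [hσ0]) ?_
      have h1 : chartCurve E (γ t) (fun s ↦ γ (1 * s + t))
          = fun s ↦ chartCurve E (γ t) γ (1 * s + t) := rfl
      rw [h1, deriv_comp_affine, hderiv]
      simp
    filter_upwards [Ioo_mem_nhdsGT hδ', nhdsWithin_le_nhds heq] with s hs hseq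
    rw [one_mul] at hseq
    calc f (γ (s + t)) + ENNReal.ofReal (s + t)
        = f (σ s) + ENNReal.ofReal s + ENNReal.ofReal t := by
          rw [hseq, add_assoc, ENNReal.ofReal_add hs.1.le ht0.le]
      _ ≤ f (γ t) + ENNReal.ofReal t := by gcongr; exact hσδ s ⟨hs.1.le, hs.2.le⟩
      _ ≤ f p := htS'
  have hend : f (γ D) + ENNReal.ofReal D ≤ 0 + ENNReal.ofReal D := by
    have h1 : f (γ D) + ENNReal.ofReal D ≤ f p := hsub ⟨ENNReal.toReal_nonneg, le_rfl⟩
    rw [zero_add]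
    exact h1.trans hfD.le
  exact ⟨γ D, nonpos_iff_eq_zero.1 (ENNReal.le_of_add_le_add_right (by simp) hend)⟩

end HopfRinow

/-! ### The equivalence -/

theorem theorem2
    {E : Type*} [NormedAddCommGroup E] [NormedSpace ℝ E] [FiniteDimensional ℝ E]
    {M : Type*} [EMetricSpace M] [ChartedSpace E M] [IsManifold 𝓘(ℝ, E) ∞ M]
    [RiemannianBundle (fun x : M ↦ TangentSpace 𝓘(ℝ, E) x)]
    [IsContMDiffRiemannianBundle 𝓘(ℝ, E) ∞ E (fun x : M ↦ TangentSpace 𝓘(ℝ, E) x)]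
    [IsRiemannianManifold 𝓘(ℝ, E) M] [NoncompactSpace M] :
    List.TFAE [
      IsGeodesicallyComplete E M,
      CompleteSpace M,
      ∀ (T : EReal) (c : ℝ → M), IsDivergentCurve E T c → curveLength E T c = ⊤,
      ∀ (T : EReal) (c : ℝ → M), IsDivergentCurve E T c →
        ContMDiffOn 𝓘(ℝ, ℝ) 𝓘(ℝ, E) ∞ c (zeroIco T) → curveLength E T c = ⊤] := by
  tfae_have 1 → 2 := fun H ↦ H.completeSpace
  tfae_have 2 → 3 := fun _ _ _ hc ↦ curveLength_eq_top_of_completeSpace hc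
  tfae_have 3 → 4 := fun H T c hc _ ↦ H T c hc
  tfae_have 4 → 1 := fun H ↦ isGeodesicallyComplete_of_curveLength_eq_top H
  tfae_finish

end
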